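/- Let $\nu>0$. For $n\ge 0$ let $$q_n^{(\nu,0)}(s)=\frac{(\nu)_n}{n!}\,{}_2F_1\!\left(-n,\,s+\tfrac{\nu}{2};\,\nu;\,2\right)$$ be the Meixner--Pollaczek polynomials, where $(\nu)_n=\nu(\nu+1)\cdots(\nu+n-1)$, and let $$M_\nu(dt)=\frac1{2\pi}\frac{2^\nu}{\Gamma(\nu)}\left|\Gamma\!\left(it+\tfrac{\nu}{2}\right)\right|^2dt .$$ The polynomials $q_n^{(\nu,0)}(it)$ form an orthogonal basis of $L^2(\mathbb R,M_\nu)$. Let $\alpha,\beta,\delta\in\mathbb R$ and $s_-,s_+\in\mathbb C$ satisfy $\alpha+2<\Re(s_-)<0<\Re(s_+)<\beta-2$ and $\delta>0$. Let $f$ be a meromorphic function on the strip $D=\{s\in\mathbb C:\alpha-\delta<\Re(s)<\beta+\delta\}$ such that, for some real $r<\frac{\pi}{2}$, $f(s)=O(e^{r|s|})$ as $s\to\infty$ in $D$. Assume that $f$ has no poles in $D$ other than $s_+$ and $s_-$, that at least one of these two points is a pole of $f$, and that each pole is simple. The residue at a point which is not a pole is $0$. Then $f(it)\in L^2(\mathbb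 R,M_\nu)$. Let $$a_n=\frac{\int_{\mathbb R} f(it)\,\overline{q_n^{(\nu,0)}(it)}\,M_\nu(dt)}{\int_{\mathbb R}|q_n^{(\nu,0)}(it)|^2\,M_\nu(dt)}\qquad(n\ge0)$$ be its MP-coefficients; whenever an expansion $f(it)=\sum_{n\ge0}b_n\,q_n^{(\nu,0)}(it)$ holds in $L^2(\mathbb R,M_\nu)$, one has $b_n=a_n$ for all $n$. Put $$A_-=2^{s_-+\frac{\nu}{2}}\,\mathrm{Res}(f,s_-)\,\Gamma\!\left(-s_-+\tfrac{\nu}{2}\right),\qquad A_+=2^{-s_++\frac{\nu}{2}}\,\mathrm{Res}(f,s_+)\,\Gamma\!\left(s_++\tfrac{\nu}{2}\right),$$ $$R_n=A_-\,n^{s_--\frac{\nu}{2}}+(-1)^{n+1}A_+\,n^{-s_+-\frac{\nu}{2}} .$$ Then $a_n\sim R_n$ as $n\to\infty$, in the following sense. 1. With $\kappa=\min\{|\Re(s_-)|,|\Re(s_+)|\}$, in all cases $$a_n=R_n+o\!\left(n^{-\kappa-\frac{\nu}{2}}\right)\qquad(n\to\infty).$$ 2. The quotient $a_n/R_n$ tends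 to $1$ as $n\to\infty$ through the integers $n$ with $R_n\neq0$, provided that - if $s_-$ is the only pole of $f$ in $D$, then $-\Re(s_-)<\beta-2$; if $s_+$ is the only pole, then $\alpha+2<-\Re(s_+)$; and - at least one of $\Re(s_+)\neq-\Re(s_-)$, $|A_-|\neq|A_+|$, $s_+=-s_-$ holds. -/

import Mathlib

open Filter Topology MeasureTheory Asymptotics

noncomputable section

/-- The Meixner-Pollaczek polynomial
`q_n^{(ν, θ)}(s) = e^{inθ} (ν)_n / n! ₂F₁(-n, s + ν/2; ν; 2 e^{-iθ} cos θ)`. -/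
def mpPoly (ν θ : ℝ) (n : ℕ) (s : ℂ) : ℂ :=
  Complex.exp (Complex.I * n * θ) * ((ascPochhammer ℂ n).eval (ν : ℂ) / (n.factorial : ℂ)) *
    ordinaryHypergeometric (-(n : ℂ)) (s + (ν : ℂ) / 2) (ν : ℂ)
      (2 * Complex.exp (-(Complex.I * θ)) * (Real.cos θ : ℂ))

/-- The measure `M_ν(dt) = (1 / 2π) (2^ν / Γ(ν)) |Γ(it + ν/2)|² dt` on the real line. -/
def mpMeasure (ν : ℝ) : Measure ℝ :=
  volume.withDensity fun t : ℝ =>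
    ENNReal.ofReal (1 / (2 * Real.pi) * ((2 : ℝ) ^ ν / Real.Gamma ν) *
      ‖Complex.Gamma (Complex.I * t + (ν : ℂ) / 2)‖ ^ 2)

/-- The expansion `f(it) = ∑ aₙ qₙ^{(ν,0)}(it)` holds in `L²(ℝ, M_ν)`. -/
def HasMPExpansion (ν : ℝ) (f : ℂ → ℂ) (a : ℕ → ℂ) : Prop :=
  Tendsto
    (fun N : ℕ => eLpNorm (fun t : ℝ => f (Complex.I * t) -
      ∑ n ∈ Finset.range N, a n * mpPoly ν 0 n (Complex.I * t)) 2 (mpMeasure ν))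
    atTop (𝓝 0)

/-- The `n`-th coefficient of `t ↦ f(it)` with respect to the orthogonal basis `qₙ^{(ν,0)}(it)`
of `L²(ℝ, M_ν)`, that is `⟨f, qₙ⟩ / ⟨qₙ, qₙ⟩`. -/
def mpCoeff (ν : ℝ) (f : ℂ → ℂ) (n : ℕ) : ℂ :=
  (∫ t : ℝ, f (Complex.I * t) * (starRingEnd ℂ) (mpPoly ν 0 n (Complex.I * t)) ∂(mpMeasure ν)) /
    ((∫ t : ℝ, ‖mpPoly ν 0 n (Complex.I * t)‖ ^ 2 ∂(mpMeasure ν) : ℝ) : ℂ)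

/-- The residue at an isolated singularity: `(1 / 2πi) ∮_{|w - z| = r} f(w) dw` for all
sufficiently small `r > 0`. -/
def residue (f : ℂ → ℂ) (z : ℂ) : ℂ :=
  limUnder (𝓝[>] (0 : ℝ)) fun r : ℝ =>
    (2 * (Real.pi : ℂ) * Complex.I)⁻¹ * circleIntegral f z r

/-- The open vertical strip `x < Re s < y`. -/
def verticalStrip (x y : ℝ) : Set ℂ := {s : ℂ | x < s.re ∧ s.re < y}

/-- `f` has a simple pole at `z`. -/
def IsSimplePole (f : ℂ → ℂ) (z : ℂ) : Prop := meromorphicOrderAt f z = -1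

/-- The constant `A₋ = 2^{s₋ + ν/2} Res(f, s₋) Γ(-s₋ + ν/2)`. -/
def constAminus (ν : ℝ) (f : ℂ → ℂ) (sm : ℂ) : ℂ :=
  (2 : ℂ) ^ (sm + (ν : ℂ) / 2) * residue f sm * Complex.Gamma (-sm + (ν : ℂ) / 2)

/-- The constant `A₊ = 2^{-s₊ + ν/2} Res(f, s₊) Γ(s₊ + ν/2)`. -/
def constAplus (ν : ℝ) (f : ℂ → ℂ) (sp : ℂ) : ℂ :=
  (2 : ℂ) ^ (-sp + (ν : ℂ) / 2) * residue f sp * Complex.Gamma (sp + (ν : ℂ) / 2)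

/-- The term `A₋ n^{s₋ - ν/2} + (-1)^{n+1} A₊ n^{-s₊ - ν/2}`. -/
def mpMainTerm (ν : ℝ) (f : ℂ → ℂ) (sm sp : ℂ) (n : ℕ) : ℂ :=
  constAminus ν f sm * (n : ℂ) ^ (sm - (ν : ℂ) / 2) +
    (-1) ^ (n + 1) * constAplus ν f sp * (n : ℂ) ^ (-sp - (ν : ℂ) / 2)

end

noncomputable section

/-! Removing the two polar parts leaves, on the imaginary axis, f(s) = c₋/(s - s₋) + c₊/(s - s₊) +
h(s), where h is holomorphic in a strip |Re s| < K + 2 and grows there at an exponential rate below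
π/2 (`exists_decomposition`).

The polar parts have explicit coefficients. The Fourier transform of q_n with respect to M_ν shows
that, for w = (1-x)/(1+x), the function w^s has n-th coefficient (1-x²)^{ν/2} x^n. Integrating
w^{s+σ} against 2dx/(1-x²) over (0,1) gives 1/(s+σ), so the coefficients of this fraction are
beta-type integrals containing x^n (`mpCoeff_one_div`). For large n only x near 1 matters, and
Euler's limit for Γ yields 2^{-σ+ν/2} Γ(σ+ν/2) n^{-σ-ν/2} (`mpPoleIntegral_isLittleO`). The
reflection s ↦ -s amounts to x ↦ -x, whence the alternating sign at s₊.

The coefficients of h are negligible. The difference operator `mpOp` is symmetric for M_ν, by a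
contour shift across a strip of width one, and has q_n as eigenfunction with eigenvalue n + ν/2.
Applying it k times multiplies the n-th coefficient by (n+ν/2)^k and costs k units of the half-width
of the strip. Cauchy–Schwarz, with ‖q_n‖² = (ν)_n/n! at least of order n^{ν-1}, then bounds the
coefficient of h by O(n^{-k+(1-ν)/2}). An integer k in [K+1, K+2) makes this o(n^{-K-ν/2})
(`ExpBoundedOnStrip.mpCoeff_isLittleO`); hence the margin 2 in the hypotheses on α and β.

For the quotient the error must be o(R_n), so |R_n| needs a lower bound where R_n ≠ 0. The only
obstruction is near-cancellation of two terms of equal size. If s₊ = -s₋ it is harmless: R_n is then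
a single power of n times one of two constants, according to the parity of n. -/

/-! ### Exponential decay of Γ on vertical lines -/

open Set in
lemma integrableOn_rpow_mul_exp_neg_mul_Ioi {σ c : ℝ} (hσ : 0 < σ) (hc : 0 < c) :
    IntegrableOn (fun t : ℝ => t ^ (σ - 1) * Real.exp (-c * t)) (Ioi 0) := by
  have h := integrableOn_rpow_mul_exp_neg_mul_rpow (s := σ - 1) (p := 1) (b := c)
    (by linarith) one_pos hc
  simpa using h

open Set in
lemma hasDerivAt_laplace_cpow {a r : ℂ} (ha : 0 < a.re) (hr : 0 < r.re) :
    HasDerivAt (fun z : ℂ => ∫ t : ℝ in Ioi 0, (t : ℂ) ^ (a - 1) * Complex.exp (-(z * t)))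
      (∫ t : ℝ in Ioi 0, (t : ℂ) ^ (a - 1) * (Complex.exp (-(r * t)) * -(t : ℂ))) r := by
  have hm : ∀ z : ℂ, AEStronglyMeasurable
      (fun t : ℝ => (t : ℂ) ^ (a - 1) * Complex.exp (-(z * t))) (volume.restrict (Ioi 0)) := by
    intro z
    refine ContinuousOn.aestronglyMeasurable (fun t ht => ?_) measurableSet_Ioi
    refine ContinuousAt.continuousWithinAt ?_
    refine ContinuousAt.mul ?_ (by fun_prop)
    exact (Complex.continuousAt_ofReal_cpow_const t _ (Or.inr (ne_of_gt ht)))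
  have hnorm : ∀ t : ℝ, 0 < t → ∀ z : ℂ, ‖(t : ℂ) ^ (a - 1) * Complex.exp (-(z * t))‖
      = t ^ (a.re - 1) * Real.exp (-z.re * t) := by
    intro t ht z
    rw [norm_mul, Complex.norm_cpow_eq_rpow_re_of_pos ht, Complex.norm_exp]
    simp
  -- Every z in the ball of radius Re r / 2 about r has Re z ≥ Re r / 2, so one integrable function
  -- dominates all the derivatives.
  have h := hasDerivAt_integral_of_dominated_loc_of_deriv_le (𝕜 := ℂ)
    (μ := volume.restrict (Ioi 0)) (s := Metric.ball r (r.re / 2)) (x₀ := r)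
    (F := fun z t => ((t : ℝ) : ℂ) ^ (a - 1) * Complex.exp (-(z * t)))
    (F' := fun z t => (t : ℂ) ^ (a - 1) * (Complex.exp (-(z * t)) * -(t : ℂ)))
    (bound := fun t => t ^ ((a.re + 1) - 1) * Real.exp (-(r.re / 2) * t))
    (Metric.ball_mem_nhds _ (by linarith)) (Eventually.of_forall hm) ?_ ?_ ?_ ?_ ?_
  · exact h.2
  · refine (integrableOn_rpow_mul_exp_neg_mul_Ioi ha hr).mono' (hm r) ?_
    refine (ae_restrict_iff' measurableSet_Ioi).2 (Eventually.of_forall fun t ht => ?_)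
    exact (hnorm t ht r).le
  · simp_rw [← mul_assoc]
    exact (hm r).mul (Complex.continuous_ofReal.neg.aestronglyMeasurable)
  · refine (ae_restrict_iff' measurableSet_Ioi).2 (Eventually.of_forall fun t ht z hz => ?_)
    have ht' : 0 < t := ht
    rw [← mul_assoc, norm_mul, hnorm t ht, norm_neg, Complex.norm_real, Real.norm_of_nonneg ht'.le]
    have h1 : t ^ (a.re + 1 - 1) = t ^ (a.re - 1) * t := by
      rw [← Real.rpow_add_one ht'.ne']; ring_nf
    rw [h1, mul_right_comm]
    have h2 : r.re / 2 ≤ z.re := by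
      have := (Complex.abs_re_le_norm (z - r)).trans (mem_ball_iff_norm.1 hz).le
      rw [Complex.sub_re, abs_le] at this
      linarith
    have : -z.re * t ≤ -(r.re / 2) * t := by nlinarith
    gcongr
  · exact integrableOn_rpow_mul_exp_neg_mul_Ioi (by linarith) (by linarith)
  · refine (ae_restrict_iff' measurableSet_Ioi).2 (Eventually.of_forall fun t ht z hz => ?_)
    refine HasDerivAt.const_mul _ ?_
    have := ((hasDerivAt_id z).mul_const (t : ℂ)).neg.cexp
    simpa using this

open Set in
-- Both sides are holomorphic in `r` on the right half plane and agree for real `r > 1`; these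
-- points accumulate at 1, and the identity theorem does the rest.
lemma laplace_cpow {a r : ℂ} (ha : 0 < a.re) (hr : 0 < r.re) :
    ∫ t : ℝ in Ioi 0, (t : ℂ) ^ (a - 1) * Complex.exp (-(r * t)) =
      (1 / r) ^ a * Complex.Gamma a := by
  set U : Set ℂ := {z | 0 < z.re}
  have hU : IsOpen U := isOpen_lt continuous_const Complex.continuous_re
  have h1 : AnalyticOnNhd ℂ
      (fun z : ℂ => ∫ t : ℝ in Ioi 0, (t : ℂ) ^ (a - 1) * Complex.exp (-(z * t))) U :=
    DifferentiableOn.analyticOnNhd (fun z hz =>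
      (hasDerivAt_laplace_cpow ha hz).differentiableAt.differentiableWithinAt) hU
  have h2 : AnalyticOnNhd ℂ (fun z : ℂ => (1 / z) ^ a * Complex.Gamma a) U := by
    refine DifferentiableOn.analyticOnNhd (fun z hz => ?_) hU
    have hz' : 0 < z.re := hz
    have hz0 : z ≠ 0 := fun h => by simp [h] at hz'
    refine DifferentiableAt.differentiableWithinAt ?_
    refine DifferentiableAt.mul_const ?_ _
    refine DifferentiableAt.cpow_const (by fun_prop (disch := assumption)) ?_
    left
    rw [one_div, Complex.inv_re]
    exact div_pos hz' (Complex.normSq_pos.2 hz0)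
  have hconv : IsPreconnected U := (convex_halfSpace_re_gt 0).isPreconnected
  have h3 : ∃ᶠ z in 𝓝[≠] (1 : ℂ),
      (∫ t : ℝ in Ioi 0, (t : ℂ) ^ (a - 1) * Complex.exp (-(z * t))) =
        (1 / z) ^ a * Complex.Gamma a := by
    have ht : Tendsto (fun x : ℝ => (x : ℂ)) (𝓝[>] 1) (𝓝[≠] (1 : ℂ)) := by
      refine tendsto_nhdsWithin_iff.2 ⟨?_, ?_⟩
      · exact (Complex.continuous_ofReal.tendsto' 1 1 (by simp)).mono_left nhdsWithin_le_nhds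
      · filter_upwards [self_mem_nhdsWithin] with x hx
        simpa using (ne_of_gt hx : x ≠ 1)
    refine ht.frequently (Eventually.frequently ?_)
    filter_upwards [self_mem_nhdsWithin] with x hx
    exact Complex.integral_cpow_mul_exp_neg_mul_Ioi ha (lt_trans one_pos hx)
  exact h1.eqOn_of_preconnected_of_frequently_eq h2 hconv (by simp [U]) h3 hr

open Set in
-- In `laplace_cpow` take r = e^{iθ}: the factor (1/r)^s has modulus e^{θ Im s}, while the integral
-- is at most its absolute version with e^{-t cos θ}. The condition |θ| < π/2 gives cos θ > 0.
lemma norm_Gamma_le {s : ℂ} {θ : ℝ} (hs : 0 < s.re) (h1 : -(Real.pi / 2) < θ)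
    (h2 : θ < Real.pi / 2) :
    ‖Complex.Gamma s‖ ≤ Real.exp (-θ * s.im) * (Real.cos θ ^ (-s.re) * Real.Gamma s.re) := by
  have hcos : 0 < Real.cos θ := Real.cos_pos_of_mem_Ioo ⟨h1, h2⟩
  set r : ℂ := Complex.exp (Complex.I * θ) with hr
  have hre : r.re = Real.cos θ := by simp [hr, Complex.exp_re]
  have h := laplace_cpow (r := r) hs (by rw [hre]; exact hcos)
  have hpow : ‖(1 / r) ^ s‖ = Real.exp (θ * s.im) := by
    have : 1 / r = Complex.exp (-(Complex.I * θ)) := by rw [hr, Complex.exp_neg, one_div]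
    rw [this, Complex.cpow_def_of_ne_zero (Complex.exp_ne_zero _), Complex.log_exp, Complex.norm_exp]
    · simp
    · simp; linarith [Real.pi_pos]
    · simp; linarith [Real.pi_pos]
  have hint : ‖∫ t : ℝ in Ioi 0, (t : ℂ) ^ (s - 1) * Complex.exp (-(r * t))‖ ≤
      Real.cos θ ^ (-s.re) * Real.Gamma s.re := by
    have h3 := Real.integral_rpow_mul_exp_neg_mul_Ioi hs hcos
    rw [one_div, Real.inv_rpow hcos.le, ← Real.rpow_neg hcos.le] at h3
    rw [← h3]
    refine norm_integral_le_of_norm_le ?_ ?_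
    · have := integrableOn_rpow_mul_exp_neg_mul_Ioi hs hcos
      simpa [IntegrableOn, neg_mul] using this
    · refine (ae_restrict_iff' measurableSet_Ioi).2 (Eventually.of_forall fun t ht => ?_)
      rw [norm_mul, Complex.norm_cpow_eq_rpow_re_of_pos ht, Complex.norm_exp]
      simp [hre]
  rw [h, norm_mul, hpow] at hint
  calc ‖Complex.Gamma s‖ = Real.exp (-θ * s.im) * (Real.exp (θ * s.im) * ‖Complex.Gamma s‖) := by
        rw [← mul_assoc, ← Real.exp_add]; simp
    _ ≤ _ := by gcongr

/-- In a vertical strip inside the right half plane, `Γ` decays like `exp (-θ |Im s|)` for every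
`θ < π / 2`. -/
lemma exists_norm_Gamma_le {a b θ : ℝ} (ha : 0 < a) (h0 : 0 ≤ θ)
    (h2 : θ < Real.pi / 2) :
    ∃ C, 0 ≤ C ∧ ∀ s : ℂ, a ≤ s.re → s.re ≤ b →
      ‖Complex.Gamma s‖ ≤ C * Real.exp (-θ * |s.im|) := by
  have hcos : 0 < Real.cos θ := Real.cos_pos_of_mem_Ioo ⟨by linarith [Real.pi_pos], h2⟩
  have hcont : ContinuousOn (fun x : ℝ => Real.cos θ ^ (-x) * Real.Gamma x) (Set.Icc a b) := by
    intro x hx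
    refine ContinuousAt.continuousWithinAt ?_
    refine ContinuousAt.mul ?_ ?_
    · exact continuousAt_const.rpow continuousAt_neg (Or.inl hcos.ne')
    · refine (Real.differentiableAt_Gamma fun m => ?_).continuousAt
      have : (0 : ℝ) ≤ m := m.cast_nonneg
      linarith [hx.1]
  obtain ⟨C, hC⟩ := isCompact_Icc.exists_bound_of_continuousOn hcont
  refine ⟨max C 0, le_max_right _ _, fun s h3 h4 => ?_⟩
  have hs : 0 < s.re := by linarith
  have hb : Real.cos θ ^ (-s.re) * Real.Gamma s.re ≤ max C 0 :=
    ((le_abs_self _).trans (hC s.re ⟨h3, h4⟩)).trans (le_max_left _ _)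
  rw [mul_comm]
  -- The angle in `norm_Gamma_le` may have either sign; it is given the sign of Im s.
  rcases le_total 0 s.im with h | h
  · rw [abs_of_nonneg h]
    exact (norm_Gamma_le hs (by linarith [Real.pi_pos]) h2).trans (by gcongr)
  · rw [abs_of_nonpos h, neg_mul_neg]
    refine (norm_Gamma_le hs (θ := -θ) (by linarith) (by linarith [Real.pi_pos])).trans ?_
    rw [neg_neg, Real.cos_neg]; gcongr

/-! ### Shifting a vertical contour -/

lemma integrable_exp_neg_mul_abs {c : ℝ} (hc : 0 < c) :
    Integrable fun t : ℝ => Real.exp (-c * |t|) := by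
  rw [← integrableOn_univ, ← Set.Iic_union_Ioi (a := (0 : ℝ))]
  refine IntegrableOn.union ?_ ?_
  · refine (integrableOn_exp_mul_Iic hc 0).congr_fun (fun t ht => ?_) measurableSet_Iic
    simp [abs_of_nonpos (show t ≤ 0 from ht)]
  · refine (integrableOn_exp_mul_Ioi (neg_lt_zero.2 hc) 0).congr_fun (fun t ht => ?_)
      measurableSet_Ioi
    simp [abs_of_pos (show 0 < t from ht)]

/-- Shift of the line of integration across the strip `0 ≤ Re s ≤ 1`. -/
lemma integral_vertical_shift {G : ℂ → ℂ} {C c : ℝ} (hc : 0 < c)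
    (hG : ∀ s : ℂ, 0 ≤ s.re → s.re ≤ 1 → DifferentiableAt ℂ G s)
    (hb : ∀ s : ℂ, 0 ≤ s.re → s.re ≤ 1 → ‖G s‖ ≤ C * Real.exp (-c * |s.im|)) :
    ∫ t : ℝ, G (Complex.I * t + 1) = ∫ t : ℝ, G (Complex.I * t) := by
  have hint : ∀ x : ℝ, 0 ≤ x → x ≤ 1 → Integrable fun t : ℝ => G (x + t * Complex.I) := by
    intro x h0 h1
    refine ((integrable_exp_neg_mul_abs hc).const_mul C).mono' ?_ (Eventually.of_forall fun t => ?_)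
    · refine Continuous.aestronglyMeasurable (continuous_iff_continuousAt.2 fun t => ?_)
      refine ContinuousAt.comp (g := G) (f := fun t : ℝ => (x : ℂ) + t * Complex.I)
        (hG _ ?_ ?_).continuousAt (by fun_prop) <;> simpa
    · simpa using hb (x + t * Complex.I) (by simpa) (by simpa)
  -- Cauchy's theorem on the rectangle [0, 1] × [-T, T]; its horizontal sides have length one and
  -- contribute at most C e^{-cT} each as T → ∞.
  have hrect : ∀ T : ℝ, Complex.I • (∫ y : ℝ in (-T)..T, G ((1 : ℝ) + y * Complex.I)) -
      Complex.I • (∫ y : ℝ in (-T)..T, G ((0 : ℝ) + y * Complex.I)) =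
      (∫ x : ℝ in (0 : ℝ)..1, G (x + T * Complex.I)) -
        ∫ x : ℝ in (0 : ℝ)..1, G (x + (-T : ℝ) * Complex.I) := by
    intro T
    have h := Complex.integral_boundary_rect_eq_zero_of_differentiableOn G
      ⟨0, -T⟩ ⟨1, T⟩ (by
        intro s hs
        have := hs.1
        simp only [Set.mem_preimage, Set.uIcc_of_le zero_le_one] at this
        exact (hG s this.1 this.2).differentiableWithinAt)
    simp only at h
    linear_combination h
  have hhor : ∀ T : ℝ, ‖∫ x : ℝ in (0 : ℝ)..1, G (x + T * Complex.I)‖ ≤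
      C * Real.exp (-c * |T|) := by
    intro T
    have := intervalIntegral.norm_integral_le_of_norm_le_const (a := 0) (b := 1)
      (f := fun x : ℝ => G (x + T * Complex.I)) (C := C * Real.exp (-c * |T|)) (by
        intro x hx
        rw [Set.uIoc_of_le zero_le_one] at hx
        simpa using hb (x + T * Complex.I) (by simpa using hx.1.le) (by simpa using hx.2))
    simpa using this
  have hexp : Tendsto (fun T : ℝ => C * Real.exp (-c * |T|)) atTop (𝓝 0) := by
    rw [← mul_zero C]
    refine Tendsto.const_mul C (Real.tendsto_exp_atBot.comp ?_)
    exact tendsto_abs_atTop_atTop.const_mul_atTop_of_neg (neg_lt_zero.2 hc)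
  have hzero : Tendsto (fun T : ℝ => (∫ x : ℝ in (0 : ℝ)..1, G (x + T * Complex.I)) -
        ∫ x : ℝ in (0 : ℝ)..1, G (x + (-T : ℝ) * Complex.I)) atTop (𝓝 0) := by
    rw [← sub_zero (0 : ℂ)]
    refine Tendsto.sub (squeeze_zero_norm hhor hexp) (squeeze_zero_norm (fun T => ?_) hexp)
    simpa using hhor (-T)
  have hlim : ∀ x : ℝ, 0 ≤ x → x ≤ 1 → Tendsto
      (fun T : ℝ => ∫ y : ℝ in (-T)..T, G (x + y * Complex.I)) atTop
      (𝓝 (∫ y : ℝ, G (x + y * Complex.I))) := fun x h0 h1 =>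
    intervalIntegral_tendsto_integral (hint x h0 h1) tendsto_neg_atTop_atBot tendsto_id
  have hl := ((hlim 1 zero_le_one le_rfl).const_smul Complex.I).sub
    ((hlim 0 le_rfl zero_le_one).const_smul Complex.I)
  have := tendsto_nhds_unique (hl.congr hrect) hzero
  rw [← smul_sub, smul_eq_zero_iff_right Complex.I_ne_zero, sub_eq_zero] at this
  convert this using 2 <;> ext t <;> push_cast <;> ring_nf

/-! ### The Mellin–Barnes beta integral -/

open Set in
lemma image_div_one_sub_Ioo : (fun y : ℝ => y / (1 - y)) '' Ioo 0 1 = Ioi 0 := by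
  ext x
  constructor
  · rintro ⟨y, hy, rfl⟩
    exact div_pos hy.1 (by linarith [hy.2])
  · intro hx
    have hx : 0 < x := hx
    refine ⟨x / (1 + x), ⟨by positivity, by rw [div_lt_one (by linarith)]; linarith⟩, ?_⟩
    have : 1 + x ≠ 0 := by linarith
    field_simp
    ring_nf

open Set in
lemma hasDerivWithinAt_div_one_sub : ∀ y ∈ Ioo (0 : ℝ) 1,
    HasDerivWithinAt (fun y : ℝ => y / (1 - y)) (1 / (1 - y) ^ 2) (Ioo 0 1) y := by
  intro y hy
  have h1 : 1 - y ≠ 0 := by linarith [hy.2]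
  have := (hasDerivAt_id y).div ((hasDerivAt_id y).const_sub 1) h1
  have e : (1 * (1 - id y) - id y * -1) / (1 - id y) ^ 2 = 1 / (1 - y) ^ 2 := by simp
  rw [e] at this
  exact this.hasDerivWithinAt

open Set in
lemma injOn_div_one_sub : InjOn (fun y : ℝ => y / (1 - y)) (Ioo 0 1) := by
  intro x hx y hy h
  have h1 : 1 - y ≠ 0 := by linarith [hy.2]
  have h2 : 1 - x ≠ 0 := by linarith [hx.2]
  simp only at h
  rw [div_eq_div_iff h2 h1] at h
  linarith

/-- The substitution x = y/(1-y), with Jacobian (1-y)⁻², carries the Mellin integral of (1+x)^{-c}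
to the integral of B(s, c-s); this is that change of variable at the level of integrands. -/
lemma beta_kernel_subst {c y : ℝ} (s : ℂ) (hy : y ∈ Set.Ioo (0 : ℝ) 1) :
    |1 / (1 - y) ^ 2| • (((y / (1 - y) : ℝ) : ℂ) ^ (s - 1) •
      (((1 + y / (1 - y)) ^ (-c) : ℝ) : ℂ)) = (y : ℂ) ^ (s - 1) * (1 - (y : ℂ)) ^ (c - s - 1) := by
  have h1 : 0 < 1 - y := by linarith [hy.2]
  have h0 := hy.1
  have e1 : 1 + y / (1 - y) = (1 - y)⁻¹ := by field_simp; ring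
  have e2 : |1 / (1 - y) ^ 2| = Real.exp (-2 * Real.log (1 - y)) := by
    rw [abs_of_pos (by positivity), neg_mul, Real.exp_neg, mul_comm, Real.exp_mul,
      Real.exp_log h1, one_div]
    norm_num
  have e3 : (1 - y)⁻¹ ^ (-c) = Real.exp (Real.log (1 - y) * c) := by
    rw [Real.inv_rpow h1.le, Real.rpow_neg h1.le, inv_inv, Real.rpow_def_of_pos h1]
  have e4 : (1 - (y : ℂ)) = ((1 - y : ℝ) : ℂ) := by push_cast; rfl
  rw [e1, e2, e3, e4, Complex.cpow_def_of_ne_zero (by exact_mod_cast (div_pos h0 h1).ne'),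
    Complex.cpow_def_of_ne_zero (by exact_mod_cast h0.ne'),
    Complex.cpow_def_of_ne_zero (by exact_mod_cast h1.ne'), ← Complex.ofReal_log h0.le,
    ← Complex.ofReal_log h1.le, ← Complex.ofReal_log (div_pos h0 h1).le,
    Real.log_div h0.ne' h1.ne', Complex.real_smul, smul_eq_mul]
  push_cast
  rw [← Complex.exp_add, ← Complex.exp_add, ← Complex.exp_add]
  congr 1
  ring

open Set in
/-- The Mellin transform of `(1 + x) ^ (-c)`. -/
lemma hasMellin_one_add_rpow {c : ℝ} {s : ℂ} (h0 : 0 < s.re) (hc : s.re < c) :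
    HasMellin (fun x : ℝ => (((1 + x) ^ (-c) : ℝ) : ℂ)) s
      (Complex.Gamma s * Complex.Gamma (c - s) / Complex.Gamma c) := by
  have hcs : 0 < (c - s).re := by simpa using hc
  have hb := Complex.Gamma_mul_Gamma_eq_betaIntegral h0 hcs
  have hcc : s + (c - s) = (c : ℂ) := by ring
  rw [hcc] at hb
  have hΓ : Complex.Gamma c ≠ 0 := Complex.Gamma_ne_zero_of_re_pos (by simp; linarith)
  constructor
  · rw [MellinConvergent, ← image_div_one_sub_Ioo, integrableOn_image_iff_integrableOn_abs_deriv_smul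
      measurableSet_Ioo hasDerivWithinAt_div_one_sub injOn_div_one_sub]
    have := (intervalIntegrable_iff_integrableOn_Ioo_of_le zero_le_one).1
      (Complex.betaIntegral_convergent h0 hcs)
    refine this.congr_fun (fun y hy => ?_) measurableSet_Ioo
    exact (beta_kernel_subst s hy).symm
  · rw [hb, mul_div_cancel_left₀ _ hΓ, mellin, ← image_div_one_sub_Ioo,
      integral_image_eq_integral_abs_deriv_smul
      measurableSet_Ioo hasDerivWithinAt_div_one_sub injOn_div_one_sub, Complex.betaIntegral,
      intervalIntegral.integral_of_le zero_le_one, integral_Ioc_eq_integral_Ioo]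
    exact setIntegral_congr_fun measurableSet_Ioo fun y hy => beta_kernel_subst s hy

lemma continuous_Gamma_add_I_mul {a : ℂ} (ha : 0 < a.re) (ε : ℝ) :
    Continuous fun t : ℝ => Complex.Gamma (a + ε * (Complex.I * t)) := by
  refine continuous_iff_continuousAt.2 fun t => ?_
  refine ContinuousAt.comp (g := Complex.Gamma) (f := fun t : ℝ => a + ε * (Complex.I * t)) ?_
    (by fun_prop)
  refine (Complex.differentiableAt_Gamma _ fun m hm => ?_).continuousAt
  have := congrArg Complex.re hm
  have hm0 : (0 : ℝ) ≤ m := m.cast_nonneg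
  simp at this
  linarith

/-- Each factor supplies the rate θ/2 < π/2. Any rate below π is thus available for the density of
M_ν. -/
lemma exists_norm_Gamma_mul_Gamma_le {a b θ : ℝ} (ha : 0 < a) (hb : 0 < b) (h0 : 0 ≤ θ)
    (h2 : θ < Real.pi) :
    ∃ C, 0 ≤ C ∧ ∀ t : ℝ, ‖Complex.Gamma (a + Complex.I * t) * Complex.Gamma (b - Complex.I * t)‖ ≤
      C * Real.exp (-θ * |t|) := by
  obtain ⟨C, hC0, hC⟩ := exists_norm_Gamma_le (b := a) ha (θ := θ / 2) (by linarith) (by linarith)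
  obtain ⟨C', hC0', hC'⟩ := exists_norm_Gamma_le (b := b) hb (θ := θ / 2) (by linarith) (by linarith)
  refine ⟨C * C', by positivity, fun t => ?_⟩
  have h1 := hC (a + Complex.I * t) (by simp) (by simp)
  have h3 := hC' (b - Complex.I * t) (by simp) (by simp)
  have e : Real.exp (-θ * |t|) = Real.exp (-(θ / 2) * |t|) * Real.exp (-(θ / 2) * |t|) := by
    rw [← Real.exp_add]; ring_nf
  rw [norm_mul, e, mul_mul_mul_comm]
  simp only [Complex.add_im, Complex.sub_im, Complex.ofReal_im, Complex.mul_im, Complex.I_re,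
    Complex.I_im, Complex.ofReal_re, zero_mul, zero_add, one_mul, zero_sub, abs_neg] at h1 h3
  gcongr

lemma norm_cpow_neg_I_mul {x : ℝ} (hx : 0 < x) (t : ℝ) : ‖(x : ℂ) ^ (-(Complex.I * t))‖ = 1 := by
  rw [Complex.norm_cpow_eq_rpow_re_of_pos hx]; simp

lemma continuous_cpow_neg_I_mul {x : ℝ} (hx : 0 < x) :
    Continuous fun t : ℝ => (x : ℂ) ^ (-(Complex.I * t)) :=
  Continuous.const_cpow (by fun_prop) (Or.inl (by exact_mod_cast hx.ne'))

lemma integrable_cpow_mul_Gamma_mul_Gamma {a b x : ℝ} (ha : 0 < a) (hb : 0 < b) (hx : 0 < x) :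
    Integrable fun t : ℝ => (x : ℂ) ^ (-(Complex.I * t)) *
      (Complex.Gamma (a + Complex.I * t) * Complex.Gamma (b - Complex.I * t)) := by
  obtain ⟨C, -, hC⟩ := exists_norm_Gamma_mul_Gamma_le ha hb zero_le_one
    (by linarith [Real.pi_gt_three])
  refine ((integrable_exp_neg_mul_abs one_pos).const_mul C).mono' ?_ (Eventually.of_forall fun t => ?_)
  · refine Continuous.aestronglyMeasurable ((continuous_cpow_neg_I_mul hx).mul ?_)
    have h1 := continuous_Gamma_add_I_mul (a := a) (by simpa) 1
    have h2 := continuous_Gamma_add_I_mul (a := b) (by simpa) (-1)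
    simp only [Complex.ofReal_one, one_mul, Complex.ofReal_neg, neg_mul, ← sub_eq_add_neg] at h1 h2
    exact h1.mul h2
  · rw [norm_mul, norm_cpow_neg_I_mul hx, one_mul]
    exact hC t

/-- The Mellin–Barnes form of the beta integral. -/
lemma integral_cpow_mul_Gamma_mul_Gamma {a b x : ℝ} (ha : 0 < a) (hb : 0 < b) (hx : 0 < x) :
    ∫ t : ℝ, (x : ℂ) ^ (-(Complex.I * t)) *
      (Complex.Gamma (a + Complex.I * t) * Complex.Gamma (b - Complex.I * t)) =
    ((2 * Real.pi * Real.Gamma (a + b) * (x ^ a * (1 + x) ^ (-(a + b))) : ℝ) : ℂ) := by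
  have hM : ∀ t : ℝ, mellin (fun x : ℝ => (((1 + x) ^ (-(a + b)) : ℝ) : ℂ)) (a + t * Complex.I) =
      (Complex.Gamma (a + Complex.I * t) * Complex.Gamma (b - Complex.I * t)) /
        Complex.Gamma (a + b) := by
    intro t
    have h := (hasMellin_one_add_rpow (c := a + b) (s := a + t * Complex.I) (by simpa)
      (by simpa)).2
    rw [h]
    push_cast
    ring_nf
  have hΓ : Complex.Gamma (a + b) ≠ 0 :=
    Complex.Gamma_ne_zero_of_re_pos (by simp; linarith)
  have h1 : (1 : ℝ) + x ≠ 0 := by linarith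
  -- Mellin inversion of (1+x)^{-(a+b)} along the line Re s = a.
  have hinv := mellinInv_mellin_eq a (fun x : ℝ => (((1 + x) ^ (-(a + b)) : ℝ) : ℂ)) hx
    (hasMellin_one_add_rpow (by simpa) (by simpa)).1 ?_ ?_
  · rw [mellinInv] at hinv
    have e : ∀ t : ℝ, (x : ℂ) ^ (-((a : ℂ) + t * Complex.I)) •
        mellin (fun x : ℝ => (((1 + x) ^ (-(a + b)) : ℝ) : ℂ)) (a + t * Complex.I) =
        ((x : ℂ) ^ (-(a : ℂ)) / Complex.Gamma (a + b)) * ((x : ℂ) ^ (-(Complex.I * t)) *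
          (Complex.Gamma (a + Complex.I * t) * Complex.Gamma (b - Complex.I * t))) := by
      intro t
      rw [hM, neg_add, Complex.cpow_add _ _ (by exact_mod_cast hx.ne'), smul_eq_mul,
        mul_comm (t : ℂ)]
      ring
    simp_rw [e] at hinv
    rw [integral_const_mul, Complex.real_smul] at hinv
    have hxa : (x : ℂ) ^ (-(a : ℂ)) = (((x ^ a)⁻¹ : ℝ) : ℂ) := by
      rw [← Complex.ofReal_neg, ← Complex.ofReal_cpow hx.le, Real.rpow_neg hx.le]
    rw [hxa] at hinv
    have hG : Complex.Gamma (a + b) = ((Real.Gamma (a + b) : ℝ) : ℂ) := by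
      rw [← Complex.Gamma_ofReal]; push_cast; rfl
    rw [hG] at hinv hΓ
    push_cast at hinv ⊢
    rw [← hinv]
    have hp : (Real.pi : ℂ) ≠ 0 := by exact_mod_cast Real.pi_ne_zero
    have hxa0 : ((x ^ a : ℝ) : ℂ) ≠ 0 := by exact_mod_cast (Real.rpow_pos_of_pos hx a).ne'
    field_simp
  · have := (integrable_cpow_mul_Gamma_mul_Gamma ha hb one_pos).div_const (Complex.Gamma (a + b))
    rw [Complex.VerticalIntegrable]
    simp_rw [hM]
    simpa using this
  · refine Complex.continuous_ofReal.continuousAt.comp ?_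
    exact ContinuousAt.rpow_const (by fun_prop) (Or.inl h1)

/-! ### Pochhammer symbols and the polynomials q_n -/

lemma Gamma_mul_ascPochhammer {a : ℂ} (ha : 0 < a.re) (k : ℕ) :
    Complex.Gamma a * (ascPochhammer ℂ k).eval a = Complex.Gamma (a + k) := by
  rw [← Complex.Gamma_add_nat_div_Gamma_eq a, mul_div_cancel₀]
  · exact Complex.Gamma_ne_zero_of_re_pos ha
  · intro m hm
    rw [hm] at ha
    have : (0 : ℝ) ≤ m := m.cast_nonneg
    simp at ha
    linarith

lemma Real.Gamma_mul_ascPochhammer {a : ℝ} (ha : 0 < a) (k : ℕ) :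
    Real.Gamma a * (ascPochhammer ℝ k).eval a = Real.Gamma (a + k) := by
  induction k with
  | zero => simp
  | succ k ih =>
    rw [ascPochhammer_succ_eval, ← mul_assoc, ih, Nat.cast_succ, ← add_assoc,
      Real.Gamma_add_one (by positivity), mul_comm]

/-- A form of the Chu–Vandermonde identity. -/
lemma sum_choose_mul_ascPochhammer (n : ℕ) : ∀ b c : ℝ,
    ∑ k ∈ Finset.range (n + 1), (-1) ^ k * (n.choose k : ℝ) * (ascPochhammer ℝ k).eval b *
      (ascPochhammer ℝ (n - k)).eval (c + k) = (ascPochhammer ℝ n).eval (c - b) := by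
  induction n with
  | zero => intro b c; simp
  | succ n ih =>
    intro b c
    -- Pascal's rule splits the sum for n + 1 in two. In the first half the last factor c + n of
    -- (c+k)_{n+1-k} comes out; in the second the first factor b of (b)_{k+1} comes out and the
    -- induction hypothesis is used at (b+1, c+1).
    have h1 : ∑ k ∈ Finset.range (n + 2), (-1) ^ k * (n.choose k : ℝ) * (ascPochhammer ℝ k).eval b *
        (ascPochhammer ℝ (n + 1 - k)).eval (c + k) =
        (c + n) * (ascPochhammer ℝ n).eval (c - b) := by
      rw [Finset.sum_range_succ, Nat.choose_succ_self, ← ih b c, Finset.mul_sum]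
      simp only [Nat.cast_zero, mul_zero, zero_mul, add_zero]
      refine Finset.sum_congr rfl fun k hk => ?_
      have hk : k ≤ n := Nat.lt_succ_iff.1 (Finset.mem_range.1 hk)
      rw [Nat.succ_sub hk, ascPochhammer_succ_eval]
      push_cast [hk]
      ring
    have h2 : ∑ k ∈ Finset.range (n + 1), (-1) ^ (k + 1) * (n.choose k : ℝ) *
        (ascPochhammer ℝ (k + 1)).eval b *
        (ascPochhammer ℝ (n - k)).eval (c + (k + 1 : ℕ)) =
        -b * (ascPochhammer ℝ n).eval (c - b) := by
      have := ih (b + 1) (c + 1)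
      rw [show c + 1 - (b + 1) = c - b by ring] at this
      rw [← this, Finset.mul_sum]
      refine Finset.sum_congr rfl fun k _ => ?_
      rw [ascPochhammer_succ_left]
      simp only [Polynomial.eval_mul, Polynomial.eval_X, Polynomial.eval_comp, Polynomial.eval_add,
        Polynomial.eval_one]
      push_cast
      ring_nf
    rw [ascPochhammer_succ_eval, Finset.sum_range_succ']
    rw [Finset.sum_range_succ'] at h1
    simp only [Nat.add_sub_add_right, Nat.choose_succ_succ', Nat.cast_add] at h1 h2 ⊢
    simp only [Nat.choose_zero_right, mul_add, add_mul, Finset.sum_add_distrib] at h1 h2 ⊢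
    linear_combination h1 + h2

/-- The squared norm `(ν)_n / n!` of the Meixner-Pollaczek polynomial of degree `n`. -/
def mpNormSq (ν : ℝ) (n : ℕ) : ℝ := (ascPochhammer ℝ n).eval ν / n.factorial

/-- The coefficient of `(s + ν/2)_k` in the Meixner-Pollaczek polynomial of degree `n`. -/
def mpPolyCoeff (ν : ℝ) (n k : ℕ) : ℝ :=
  mpNormSq ν n * ((-2) ^ k * n.choose k / (ascPochhammer ℝ k).eval ν)

lemma mpNormSq_pos {ν : ℝ} (hν : 0 < ν) (n : ℕ) : 0 < mpNormSq ν n :=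
  div_pos (ascPochhammer_pos n ν hν) (by exact_mod_cast n.factorial_pos)

lemma ascPochhammer_eval_ofReal (k : ℕ) (x : ℝ) :
    (ascPochhammer ℂ k).eval (x : ℂ) = (((ascPochhammer ℝ k).eval x : ℝ) : ℂ) := by
  induction k with
  | zero => simp
  | succ k ih => rw [ascPochhammer_succ_eval, ascPochhammer_succ_eval, ih]; push_cast; rfl

lemma conj_ascPochhammer_eval (k : ℕ) (z : ℂ) :
    (starRingEnd ℂ) ((ascPochhammer ℂ k).eval z) = (ascPochhammer ℂ k).eval ((starRingEnd ℂ) z) := by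
  induction k with
  | zero => simp
  | succ k ih => rw [ascPochhammer_succ_eval, ascPochhammer_succ_eval, map_mul, ih]; simp

/-- The hypergeometric series terminates: (-n)_k = (-1)^k n!/(n-k)! for k ≤ n, and it vanishes for k
> n. -/
lemma mpPoly_eq_sum (ν : ℝ) (n : ℕ) (s : ℂ) :
    mpPoly ν 0 n s = ∑ k ∈ Finset.range (n + 1),
      (mpPolyCoeff ν n k : ℂ) * (ascPochhammer ℂ k).eval (s + (ν : ℂ) / 2) := by
  rw [mpPoly, ordinaryHypergeometric_eq_tsum]
  beta_reduce
  rw [tsum_eq_sum (s := Finset.range (n + 1))]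
  · simp only [Complex.ofReal_zero, mul_zero, neg_zero, Complex.exp_zero, Real.cos_zero,
      Complex.ofReal_one, mul_one, one_mul, smul_eq_mul]
    rw [Finset.mul_sum]
    refine Finset.sum_congr rfl fun k _ => ?_
    rw [ascPochhammer_eval_neg_eq_descPochhammer, descPochhammer_eval_eq_descFactorial,
      Nat.descFactorial_eq_factorial_mul_choose, ascPochhammer_eval_ofReal,
      ascPochhammer_eval_ofReal, mpPolyCoeff, mpNormSq]
    have : (k.factorial : ℂ) ≠ 0 := by exact_mod_cast k.factorial_ne_zero
    push_cast
    rw [neg_pow (2 : ℂ)]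
    field_simp
  · intro k hk
    have hk : n < k := by simpa using hk
    rw [ascPochhammer_eval_neg_eq_descPochhammer, descPochhammer_eval_eq_descFactorial,
      Nat.descFactorial_of_lt hk]
    simp

/-- The coefficients are real and conjugation reflects the imaginary axis. Inner products with q_n
thereby become integrals of functions holomorphic in s, to which contour shifts apply. -/
lemma conj_mpPoly (ν : ℝ) (n : ℕ) (t : ℝ) :
    (starRingEnd ℂ) (mpPoly ν 0 n (Complex.I * t)) = mpPoly ν 0 n (-(Complex.I * t)) := by
  simp_rw [mpPoly_eq_sum, map_sum, map_mul, conj_ascPochhammer_eval]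
  simp [Complex.conj_ofNat]

/-! ### Functions of exponential growth in a symmetric strip -/

/-- `h` is holomorphic in the strip `|Re s| < K` and is there `O(exp (r |Im s|))`. -/
structure ExpBoundedOnStrip (K r : ℝ) (h : ℂ → ℂ) : Prop where
  differentiableAt : ∀ s : ℂ, |s.re| < K → DifferentiableAt ℂ h s
  exists_bound : ∃ C, 0 ≤ C ∧ ∀ s : ℂ, |s.re| < K → ‖h s‖ ≤ C * Real.exp (r * |s.im|)

namespace ExpBoundedOnStrip

variable {K K' r r' : ℝ} {h g : ℂ → ℂ}

lemma mono (H : ExpBoundedOnStrip K r h) (hK : K' ≤ K) (hr : r ≤ r') :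
    ExpBoundedOnStrip K' r' h := by
  obtain ⟨C, hC0, hC⟩ := H.exists_bound
  refine ⟨fun s hs => H.1 s (hs.trans_le hK), C, hC0, fun s hs => (hC s (hs.trans_le hK)).trans ?_⟩
  gcongr

lemma add (H : ExpBoundedOnStrip K r h) (G : ExpBoundedOnStrip K r g) :
    ExpBoundedOnStrip K r (fun s => h s + g s) := by
  obtain ⟨C, hC0, hC⟩ := H.exists_bound
  obtain ⟨C', hC0', hC'⟩ := G.exists_bound
  refine ⟨fun s hs => (H.1 s hs).add (G.1 s hs), C + C', by positivity, fun s hs => ?_⟩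
  rw [add_mul]
  exact (norm_add_le _ _).trans (add_le_add (hC s hs) (hC' s hs))

lemma mul (H : ExpBoundedOnStrip K r h) (G : ExpBoundedOnStrip K r' g) :
    ExpBoundedOnStrip K (r + r') (fun s => h s * g s) := by
  obtain ⟨C, hC0, hC⟩ := H.exists_bound
  obtain ⟨C', hC0', hC'⟩ := G.exists_bound
  refine ⟨fun s hs => (H.1 s hs).mul (G.1 s hs), C * C', by positivity, fun s hs => ?_⟩
  rw [add_mul, Real.exp_add, mul_mul_mul_comm, norm_mul]
  have h1 := hC s hs
  have h2 := hC' s hs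
  gcongr

lemma const (K : ℝ) (hr : 0 ≤ r) (c : ℂ) : ExpBoundedOnStrip K r (fun _ => c) := by
  refine ⟨fun s _ => by fun_prop, ‖c‖, norm_nonneg _, fun s _ => ?_⟩
  have : 1 ≤ Real.exp (r * |s.im|) := Real.one_le_exp (by positivity)
  nlinarith [norm_nonneg c]

lemma id (K : ℝ) (hr : 0 < r) : ExpBoundedOnStrip K r (fun s => s) := by
  refine ⟨fun s _ => by fun_prop, |K| + r⁻¹, by positivity, fun s hs => ?_⟩
  have h1 := Complex.norm_le_abs_re_add_abs_im s
  have h2 : |s.re| ≤ |K| := hs.le.trans (le_abs_self K)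
  have h3 := Real.add_one_le_exp (r * |s.im|)
  have h4 : 1 ≤ Real.exp (r * |s.im|) := Real.one_le_exp (by positivity)
  have h5 : |s.im| ≤ r⁻¹ * Real.exp (r * |s.im|) := by
    rw [inv_mul_eq_div, le_div_iff₀ hr]; linarith
  nlinarith [abs_nonneg K]

lemma neg (H : ExpBoundedOnStrip K r h) : ExpBoundedOnStrip K r (fun s => h (-s)) := by
  obtain ⟨C, hC0, hC⟩ := H.exists_bound
  refine ⟨fun s hs => ?_, C, hC0, fun s hs => by simpa using hC (-s) (by simpa)⟩
  exact DifferentiableAt.comp (g := h) (f := fun s => -s) s (H.1 _ (by simpa)) (by fun_prop)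

lemma shift (H : ExpBoundedOnStrip K r h) {c : ℝ} (hc : |c| ≤ 1) :
    ExpBoundedOnStrip (K - 1) r (fun s => h (s + c)) := by
  have hs' : ∀ s : ℂ, |s.re| < K - 1 → |(s + c).re| < K := by
    intro s hs
    have := abs_add_le s.re c
    simp only [Complex.add_re, Complex.ofReal_re]
    linarith
  obtain ⟨C, hC0, hC⟩ := H.exists_bound
  refine ⟨fun s hs => ?_, C, hC0, fun s hs => by simpa using hC (s + c) (hs' s hs)⟩
  exact DifferentiableAt.comp (g := h) (f := fun s : ℂ => s + c) s (H.1 _ (hs' s hs)) (by fun_prop)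

lemma sum {ι : Type*} (S : Finset ι) {p : ι → ℂ → ℂ} (hr : 0 ≤ r)
    (H : ∀ i ∈ S, ExpBoundedOnStrip K r (p i)) :
    ExpBoundedOnStrip K r (fun s => ∑ i ∈ S, p i s) := by
  classical
  induction S using Finset.induction_on with
  | empty => simpa using const K hr 0
  | insert i S hi ih =>
    simp_rw [Finset.sum_insert hi]
    exact (H i (by simp)).add (ih fun j hj => H j (by simp [hj]))

lemma ascPochhammer (K : ℝ) (k : ℕ) (c : ℂ) : ∀ {r : ℝ}, 0 < r →
    ExpBoundedOnStrip K r (fun s => (_root_.ascPochhammer ℂ k).eval (s + c)) := by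
  induction k with
  | zero => intro r hr; simpa using const K hr.le 1
  | succ k ih =>
    intro r hr
    simp_rw [ascPochhammer_succ_eval]
    rw [← add_halves r]
    refine (ih (half_pos hr)).mul ?_
    exact ((id K (half_pos hr)).add (const K (half_pos hr).le c)).add (const K (half_pos hr).le _)

lemma mpPoly (ν K : ℝ) (n : ℕ) (hr : 0 < r) : ExpBoundedOnStrip K r (mpPoly ν 0 n) := by
  have : _root_.mpPoly ν 0 n = fun s => ∑ k ∈ Finset.range (n + 1),
      (mpPolyCoeff ν n k : ℂ) * (_root_.ascPochhammer ℂ k).eval (s + (ν : ℂ) / 2) :=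
    funext (mpPoly_eq_sum ν n)
  rw [this]
  refine sum _ hr.le fun k _ => ?_
  simpa using (const K le_rfl (mpPolyCoeff ν n k : ℂ)).mul (ascPochhammer K k ((ν : ℂ) / 2) hr)

lemma continuous_vertical (H : ExpBoundedOnStrip K r h) (hK : 0 < K) :
    Continuous fun t : ℝ => h (Complex.I * t) := by
  refine continuous_iff_continuousAt.2 fun t => ?_
  exact ContinuousAt.comp (g := h) (f := fun t : ℝ => Complex.I * t)
    (H.1 _ (by simpa)).continuousAt (by fun_prop)

end ExpBoundedOnStrip

/-! ### The measure M_ν and square integrability -/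

/-- The density of the measure `M_ν`. -/
def mpDensity (ν t : ℝ) : ℝ :=
  1 / (2 * Real.pi) * ((2 : ℝ) ^ ν / Real.Gamma ν) *
      ‖Complex.Gamma (Complex.I * t + (ν : ℂ) / 2)‖ ^ 2

lemma mpConst_pos {ν : ℝ} (hν : 0 < ν) :
    0 < 1 / (2 * Real.pi) * ((2 : ℝ) ^ ν / Real.Gamma ν) := by
  have := Real.pi_pos
  have := Real.Gamma_pos_of_pos hν
  positivity

lemma mpDensity_nonneg {ν : ℝ} (hν : 0 < ν) (t : ℝ) : 0 ≤ mpDensity ν t :=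
  mul_nonneg (mpConst_pos hν).le (by positivity)

/-- Since Γ commutes with conjugation, |Γ(ν/2+it)|² is the value at s = it of Γ(ν/2+s)Γ(ν/2-s). In
this holomorphic form the density enters Mellin–Barnes integrals and contour shifts. -/
lemma ofReal_mpDensity (ν t : ℝ) : (mpDensity ν t : ℂ) =
    ((1 / (2 * Real.pi) * ((2 : ℝ) ^ ν / Real.Gamma ν) : ℝ) : ℂ) *
      (Complex.Gamma ((ν / 2 : ℝ) + Complex.I * t) * Complex.Gamma ((ν / 2 : ℝ) - Complex.I * t)) := by
  have h : (starRingEnd ℂ) (Complex.Gamma ((ν / 2 : ℝ) + Complex.I * t)) =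
      Complex.Gamma ((ν / 2 : ℝ) - Complex.I * t) := by
    rw [← Complex.Gamma_conj]; congr 1; simp [sub_eq_add_neg, Complex.conj_ofNat]
  rw [mpDensity, ← h, Complex.mul_conj, Complex.normSq_eq_norm_sq, add_comm (Complex.I * (t : ℂ))]
  push_cast
  rfl

lemma continuous_mpDensity {ν : ℝ} (hν : 0 < ν) : Continuous (mpDensity ν) := by
  have := continuous_Gamma_add_I_mul (a := (ν : ℂ) / 2) (by simpa) 1
  simp only [Complex.ofReal_one, one_mul] at this
  unfold mpDensity
  simp_rw [add_comm (Complex.I * _)]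
  exact continuous_const.mul (this.norm.pow 2)

lemma exists_mpDensity_le {ν θ : ℝ} (hν : 0 < ν) (h0 : 0 ≤ θ) (h2 : θ < Real.pi) :
    ∃ C, 0 ≤ C ∧ ∀ t, mpDensity ν t ≤ C * Real.exp (-θ * |t|) := by
  obtain ⟨C, hC0, hC⟩ := exists_norm_Gamma_mul_Gamma_le (half_pos hν) (half_pos hν) h0 h2
  refine ⟨_, mul_nonneg (mpConst_pos hν).le hC0, fun t => ?_⟩
  have := congrArg norm (ofReal_mpDensity ν t)
  rw [Complex.norm_real, Real.norm_of_nonneg (mpDensity_nonneg hν t), norm_mul,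
    Complex.norm_real, Real.norm_of_nonneg (mpConst_pos hν).le] at this
  rw [this, mul_assoc _ C]
  exact mul_le_mul_of_nonneg_left (hC t) (mpConst_pos hν).le

lemma mpMeasure_eq (ν : ℝ) :
    mpMeasure ν = volume.withDensity fun t => ENNReal.ofReal (mpDensity ν t) := rfl

lemma integral_mpMeasure {E : Type*} [NormedAddCommGroup E] [NormedSpace ℝ E]
    {ν : ℝ} (hν : 0 < ν) (g : ℝ → E) :
    ∫ t, g t ∂mpMeasure ν = ∫ t, mpDensity ν t • g t := by
  rw [mpMeasure_eq, integral_withDensity_eq_integral_toReal_smul]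
  · simp_rw [ENNReal.toReal_ofReal (mpDensity_nonneg hν _)]
  · exact (continuous_mpDensity hν).measurable.ennreal_ofReal
  · simp

lemma integrable_mpMeasure_iff {E : Type*} [NormedAddCommGroup E] [NormedSpace ℝ E]
    {ν : ℝ} (hν : 0 < ν) {g : ℝ → E} :
    Integrable g (mpMeasure ν) ↔ Integrable fun t => mpDensity ν t • g t := by
  rw [mpMeasure_eq, integrable_withDensity_iff_integrable_smul']
  · simp_rw [ENNReal.toReal_ofReal (mpDensity_nonneg hν _)]
  · exact (continuous_mpDensity hν).measurable.ennreal_ofReal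
  · simp

lemma integrable_mpMeasure_of_bound {E : Type*} [NormedAddCommGroup E] [NormedSpace ℝ E]
    {ν C r : ℝ} (hν : 0 < ν) (hr : r < Real.pi) {g : ℝ → E}
    (hg : Continuous g) (hb : ∀ t, ‖g t‖ ≤ C * Real.exp (r * |t|)) :
    Integrable g (mpMeasure ν) := by
  rw [integrable_mpMeasure_iff hν]
  -- The density decays at any rate θ < π; choosing θ > r leaves the surplus rate θ - r.
  obtain ⟨θ, h1, h2⟩ := exists_between (max_lt hr Real.pi_pos)
  obtain ⟨D, hD0, hD⟩ := exists_mpDensity_le hν ((le_max_right _ _).trans h1.le) h2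
  have hθ : 0 < θ - r := by linarith [le_max_left r 0]
  refine ((integrable_exp_neg_mul_abs hθ).const_mul (D * C)).mono'
    ((continuous_mpDensity hν).smul hg).aestronglyMeasurable (Eventually.of_forall fun t => ?_)
  rw [norm_smul, Real.norm_of_nonneg (mpDensity_nonneg hν t)]
  calc mpDensity ν t * ‖g t‖ ≤ (D * Real.exp (-θ * |t|)) * (C * Real.exp (r * |t|)) :=
        mul_le_mul (hD t) (hb t) (norm_nonneg _) (by positivity)
    _ = _ := by rw [mul_mul_mul_comm, ← Real.exp_add]; ring_nf

/-- Squaring doubles the growth rate, and the density absorbs any rate below π: this is the role of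
r < π/2. -/
lemma memLp_mpMeasure_of_bound {ν C r : ℝ} (hν : 0 < ν) (hr : r < Real.pi / 2) {g : ℝ → ℂ}
    (hg : Continuous g) (hb : ∀ t, ‖g t‖ ≤ C * Real.exp (r * |t|)) :
    MemLp g 2 (mpMeasure ν) := by
  rw [memLp_two_iff_integrable_sq_norm hg.aestronglyMeasurable]
  refine integrable_mpMeasure_of_bound (C := C ^ 2) (r := 2 * r) hν (by linarith)
    (hg.norm.pow 2) fun t => ?_
  rw [norm_pow, norm_norm, mul_assoc, two_mul, Real.exp_add, ← sq, ← mul_pow]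
  exact pow_le_pow_left₀ (norm_nonneg _) (hb t) 2

lemma ExpBoundedOnStrip.memLp {ν K r : ℝ} {h : ℂ → ℂ} (H : ExpBoundedOnStrip K r h) (hν : 0 < ν)
    (hK : 0 < K) (hr : r < Real.pi / 2) :
    MemLp (fun t : ℝ => h (Complex.I * t)) 2 (mpMeasure ν) := by
  obtain ⟨C, -, hC⟩ := H.exists_bound
  exact memLp_mpMeasure_of_bound hν hr (H.continuous_vertical hK)
    fun t => by simpa using hC (Complex.I * t) (by simpa)

lemma ExpBoundedOnStrip.integrable {ν K r : ℝ} {h : ℂ → ℂ} (H : ExpBoundedOnStrip K r h)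
    (hν : 0 < ν) (hK : 0 < K) (hr : r < Real.pi) :
    Integrable (fun t : ℝ => h (Complex.I * t)) (mpMeasure ν) := by
  obtain ⟨C, -, hC⟩ := H.exists_bound
  exact integrable_mpMeasure_of_bound hν hr (H.continuous_vertical hK)
    fun t => by simpa using hC (Complex.I * t) (by simpa)

lemma memLp_mpPoly {ν : ℝ} (hν : 0 < ν) (n : ℕ) :
    MemLp (fun t : ℝ => mpPoly ν 0 n (Complex.I * t)) 2 (mpMeasure ν) :=
  (ExpBoundedOnStrip.mpPoly ν 1 n one_pos).memLp hν one_pos (by linarith [Real.pi_gt_three])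

lemma isFiniteMeasure_mpMeasure {ν : ℝ} (hν : 0 < ν) : IsFiniteMeasure (mpMeasure ν) := by
  have := integrable_mpMeasure_of_bound (g := fun _ => (1 : ℝ)) (C := 1) (r := 0) hν Real.pi_pos
    continuous_const (by simp)
  exact (integrable_const_iff_isFiniteMeasure one_ne_zero).1 this

/-! ### Fourier transform and orthogonality of q_n -/

lemma ascPochhammer_eval_add_nat (a : ℝ) (n m : ℕ) :
    (ascPochhammer ℝ (n + m)).eval a =
      (ascPochhammer ℝ n).eval a * (ascPochhammer ℝ m).eval (a + n) := by
  rw [← ascPochhammer_mul]; simp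

/-- The Γ-factors of the density absorb the Pochhammer symbols, so the weighted moments are
Mellin–Barnes integrals with parameters ν/2 + k and ν/2 + j. -/
lemma mpDensity_smul_ascPochhammer {ν : ℝ} (hν : 0 < ν) (k j : ℕ) (t : ℝ) (z : ℂ) :
    mpDensity ν t • (z * ((ascPochhammer ℂ k).eval (Complex.I * t + (ν : ℂ) / 2) *
      (ascPochhammer ℂ j).eval (-(Complex.I * t) + (ν : ℂ) / 2))) =
    ((1 / (2 * Real.pi) * ((2 : ℝ) ^ ν / Real.Gamma ν) : ℝ) : ℂ) *
      (z * (Complex.Gamma ((ν / 2 + k : ℝ) + Complex.I * t) *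
        Complex.Gamma ((ν / 2 + j : ℝ) - Complex.I * t))) := by
  have h1 := Gamma_mul_ascPochhammer (a := (ν / 2 : ℝ) + Complex.I * t) (by simpa) k
  have h2 := Gamma_mul_ascPochhammer (a := (ν / 2 : ℝ) - Complex.I * t) (by simpa) j
  have e1 : (ν / 2 : ℝ) + Complex.I * t + k = (ν / 2 + k : ℝ) + Complex.I * t := by
    push_cast; ring
  have e2 : (ν / 2 : ℝ) - Complex.I * t + j = (ν / 2 + j : ℝ) - Complex.I * t := by
    push_cast; ring
  have e3 : Complex.I * t + (ν : ℂ) / 2 = (ν / 2 : ℝ) + Complex.I * t := by push_cast; ring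
  have e4 : -(Complex.I * t) + (ν : ℂ) / 2 = (ν / 2 : ℝ) - Complex.I * t := by push_cast; ring
  rw [e1] at h1
  rw [e2] at h2
  rw [Complex.real_smul, ofReal_mpDensity, e3, e4, ← h1, ← h2]
  ring

lemma integrable_cpow_mul_ascPochhammer {ν x : ℝ} (hν : 0 < ν) (hx : 0 < x) (k j : ℕ) :
    Integrable (fun t : ℝ => (x : ℂ) ^ (-(Complex.I * t)) *
      ((ascPochhammer ℂ k).eval (Complex.I * t + (ν : ℂ) / 2) *
      (ascPochhammer ℂ j).eval (-(Complex.I * t) + (ν : ℂ) / 2))) (mpMeasure ν) := by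
  rw [integrable_mpMeasure_iff hν]
  simp_rw [mpDensity_smul_ascPochhammer hν]
  exact (integrable_cpow_mul_Gamma_mul_Gamma (by positivity) (by positivity) hx).const_mul _

lemma integral_cpow_mul_ascPochhammer {ν x : ℝ} (hν : 0 < ν) (hx : 0 < x) (k j : ℕ) :
    ∫ t : ℝ, (x : ℂ) ^ (-(Complex.I * t)) *
      ((ascPochhammer ℂ k).eval (Complex.I * t + (ν : ℂ) / 2) *
      (ascPochhammer ℂ j).eval (-(Complex.I * t) + (ν : ℂ) / 2)) ∂mpMeasure ν =
    ((2 ^ ν * (ascPochhammer ℝ (k + j)).eval ν *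
      (x ^ (ν / 2 + k) * (1 + x) ^ (-(ν + k + j))) : ℝ) : ℂ) := by
  rw [integral_mpMeasure hν]
  simp_rw [mpDensity_smul_ascPochhammer hν]
  rw [integral_const_mul, integral_cpow_mul_Gamma_mul_Gamma (by positivity) (by positivity) hx,
    ← Complex.ofReal_mul, show ν / 2 + k + (ν / 2 + j) = ν + ((k + j : ℕ) : ℝ) by push_cast; ring,
    ← Real.Gamma_mul_ascPochhammer hν]
  have := Real.pi_ne_zero
  have := (Real.Gamma_pos_of_pos hν).ne'
  congr 1
  push_cast
  rw [← add_assoc]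
  field_simp

/-- The (ν)_k produced by the moments cancels the one in `mpPolyCoeff`, and the binomial theorem
remains. At y = x/(1+x) the base 1 - 2y is (1-x)/(1+x). -/
lemma sum_mpPolyCoeff_mul {ν : ℝ} (hν : 0 < ν) (n : ℕ) (y : ℝ) :
    ∑ k ∈ Finset.range (n + 1), mpPolyCoeff ν n k * ((ascPochhammer ℝ k).eval ν * y ^ k) =
      mpNormSq ν n * (1 - 2 * y) ^ n := by
  rw [show 1 - 2 * y = -2 * y + 1 by ring, add_pow, Finset.mul_sum]
  refine Finset.sum_congr rfl fun k _ => ?_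
  have := (ascPochhammer_pos k ν hν).ne'
  rw [mpPolyCoeff, mul_pow]
  field_simp
  simp

/-- The Fourier transform of the Meixner-Pollaczek polynomials with respect to `M_ν`. -/
lemma integral_cpow_mul_mpPoly {ν x : ℝ} (hν : 0 < ν) (hx : 0 < x) (n : ℕ) :
    ∫ t : ℝ, (x : ℂ) ^ (-(Complex.I * t)) * mpPoly ν 0 n (Complex.I * t) ∂mpMeasure ν =
    ((mpNormSq ν n * (2 ^ ν * x ^ (ν / 2) * (1 + x) ^ (-ν) * ((1 - x) / (1 + x)) ^ n) : ℝ) : ℂ) := by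
  have hint := fun k => integrable_cpow_mul_ascPochhammer hν hx k 0
  have hval := fun k => integral_cpow_mul_ascPochhammer hν hx k 0
  simp only [ascPochhammer_zero, Polynomial.eval_one, mul_one, add_zero, Nat.cast_zero] at hint hval
  simp_rw [mpPoly_eq_sum, Finset.mul_sum, mul_left_comm _ ((mpPolyCoeff ν n _ : ℝ) : ℂ)]
  rw [integral_finsetSum _ fun k _ => (hint k).const_mul _]
  simp_rw [integral_const_mul, hval]
  have h1 : 1 + x ≠ 0 := by linarith
  have hy : (1 - x) / (1 + x) = 1 - 2 * (x / (1 + x)) := by field_simp; ring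
  rw [hy, mul_left_comm, ← sum_mpPolyCoeff_mul hν n, Finset.mul_sum]
  push_cast
  refine Finset.sum_congr rfl fun k _ => ?_
  norm_cast
  rw [Real.rpow_add hx, neg_add, Real.rpow_add (by linarith), Real.rpow_natCast, Real.rpow_neg
    (by linarith) (k : ℝ), Real.rpow_natCast, div_pow]
  ring

lemma integral_cpow_mul_conj_mpPoly {ν x : ℝ} (hν : 0 < ν) (hx : 0 < x) (n : ℕ) :
    ∫ t : ℝ, (x : ℂ) ^ (Complex.I * t) * (starRingEnd ℂ) (mpPoly ν 0 n (Complex.I * t))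
      ∂mpMeasure ν =
    ((mpNormSq ν n * (2 ^ ν * x ^ (ν / 2) * (1 + x) ^ (-ν) * ((1 - x) / (1 + x)) ^ n) : ℝ) : ℂ) := by
  have h := congrArg (starRingEnd ℂ) (integral_cpow_mul_mpPoly hν hx n)
  rw [← integral_conj, Complex.conj_ofReal] at h
  rw [← h]
  congr 1
  ext t
  have harg : (x : ℂ).arg ≠ Real.pi := by
    rw [Complex.arg_ofReal_of_nonneg hx.le]
    exact Real.pi_ne_zero.symm
  have := Complex.cpow_conj (x : ℂ) (-(Complex.I * t)) harg
  rw [map_mul, ← Complex.conj_ofReal x, ← this, Complex.conj_ofReal]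
  simp

/-- The moments at x = 1 are summed by Chu–Vandermonde with b = ν + j and c = ν. The resulting
factor (-j)_n vanishes for j < n, which is orthogonality to lower degrees. -/
lemma integral_mpPoly_mul_ascPochhammer {ν : ℝ} (hν : 0 < ν) (n j : ℕ) :
    ∫ t : ℝ, mpPoly ν 0 n (Complex.I * t) *
      (ascPochhammer ℂ j).eval (-(Complex.I * t) + (ν : ℂ) / 2) ∂mpMeasure ν =
    ((2⁻¹ ^ j * (ascPochhammer ℝ j).eval ν / n.factorial * (ascPochhammer ℝ n).eval (-(j : ℝ)) : ℝ) : ℂ) := by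
  have hint := fun k => integrable_cpow_mul_ascPochhammer hν one_pos k j
  have hval := fun k => integral_cpow_mul_ascPochhammer hν one_pos k j
  simp only [Complex.ofReal_one, Complex.one_cpow, one_mul, Real.one_rpow] at hint hval
  simp_rw [mpPoly_eq_sum, Finset.sum_mul, mul_assoc]
  rw [integral_finsetSum _ fun k _ => (hint k).const_mul _]
  simp_rw [integral_const_mul, hval]
  have hV := sum_choose_mul_ascPochhammer n (ν + j) ν
  rw [show ν - (ν + j) = -(j : ℝ) by ring] at hV
  rw [← hV, Finset.mul_sum, Complex.ofReal_sum]
  refine Finset.sum_congr rfl fun k hk => ?_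
  have hk : k ≤ n := Nat.lt_succ_iff.1 (Finset.mem_range.1 hk)
  have h2 : (1 + 1 : ℝ) ^ (-(ν + k + j)) = (2 ^ ν)⁻¹ * 2⁻¹ ^ k * 2⁻¹ ^ j := by
    rw [one_add_one_eq_two, Real.rpow_neg two_pos.le, Real.rpow_add two_pos, Real.rpow_add two_pos,
      Real.rpow_natCast, Real.rpow_natCast]
    simp
    ring
  have h3 := ascPochhammer_eval_add_nat ν k (n - k)
  rw [Nat.add_sub_cancel' hk] at h3
  have h4 := ascPochhammer_eval_add_nat ν j k
  rw [add_comm j k] at h4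
  have h5 := (ascPochhammer_pos k ν hν).ne'
  have h6 : (2 : ℝ) ^ ν ≠ 0 := (Real.rpow_pos_of_pos two_pos ν).ne'
  have h7 : (-2 : ℝ) ^ k * 2⁻¹ ^ k = (-1) ^ k := by rw [← mul_pow]; norm_num
  rw [← Complex.ofReal_mul, mpPolyCoeff, mpNormSq, h3, h4, h2, ← h7]
  congr 1
  field_simp

/-- Restricted to a negated argument so that rewriting expands only the conjugated factor of an
inner product. -/
lemma mpPoly_neg_eq_sum (ν : ℝ) (n : ℕ) (s : ℂ) :
    mpPoly ν 0 n (-s) = ∑ k ∈ Finset.range (n + 1),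
      (mpPolyCoeff ν n k : ℂ) * (ascPochhammer ℂ k).eval (-s + (ν : ℂ) / 2) :=
  mpPoly_eq_sum ν n (-s)

lemma integrable_mpPoly_mul_ascPochhammer {ν : ℝ} (hν : 0 < ν) (n j : ℕ) :
    Integrable (fun t : ℝ => mpPoly ν 0 n (Complex.I * t) *
      (ascPochhammer ℂ j).eval (-(Complex.I * t) + (ν : ℂ) / 2)) (mpMeasure ν) :=
  ((ExpBoundedOnStrip.mpPoly ν 1 n one_pos).mul
    (ExpBoundedOnStrip.ascPochhammer 1 j ((ν : ℂ) / 2) one_pos).neg).integrable hν one_pos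
      (by linarith [Real.pi_gt_three])

lemma integral_mpPoly_mul_conj_of_le {ν : ℝ} (hν : 0 < ν) {n m : ℕ} (hmn : m ≤ n) :
    ∫ t : ℝ, mpPoly ν 0 n (Complex.I * t) * (starRingEnd ℂ) (mpPoly ν 0 m (Complex.I * t))
      ∂mpMeasure ν = if n = m then (mpNormSq ν n : ℂ) else 0 := by
  simp_rw [conj_mpPoly, mpPoly_neg_eq_sum, Finset.mul_sum,
    mul_left_comm _ ((mpPolyCoeff ν m _ : ℝ) : ℂ)]
  rw [integral_finsetSum _ fun k _ =>
    (integrable_mpPoly_mul_ascPochhammer hν n k).const_mul _]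
  simp_rw [integral_const_mul, integral_mpPoly_mul_ascPochhammer hν]
  have hz : ∀ k < n, (ascPochhammer ℝ n).eval (-(k : ℝ)) = 0 := fun k hk => by
    rw [ascPochhammer_eval_neg_eq_descPochhammer, descPochhammer_eval_eq_descFactorial,
      Nat.descFactorial_of_lt hk]
    simp
  -- All terms with k < m vanish because m ≤ n; the top term k = m survives only if m = n.
  rw [Finset.sum_range_succ, Finset.sum_eq_zero, zero_add]
  · split_ifs with h
    · subst h
      rw [ascPochhammer_eval_neg_eq_descPochhammer, descPochhammer_eval_eq_descFactorial,
        Nat.descFactorial_self, mpPolyCoeff]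
      norm_cast
      have h5 := (ascPochhammer_pos n ν hν).ne'
      have h6 : (n.factorial : ℝ) ≠ 0 := by exact_mod_cast n.factorial_ne_zero
      have h7 : (-2 : ℝ) ^ n * 2⁻¹ ^ n * (-1) ^ n = 1 := by rw [← mul_pow, ← mul_pow]; norm_num
      push_cast
      rw [Nat.choose_self]
      field_simp
      linear_combination mpNormSq ν n * h7
    · rw [hz m (lt_of_le_of_ne hmn (Ne.symm h))]
      simp
  · intro k hk
    rw [hz k (lt_of_lt_of_le (Finset.mem_range.1 hk) hmn)]
    simp

/-- Orthogonality of the Meixner-Pollaczek polynomials. -/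
lemma integral_mpPoly_mul_conj {ν : ℝ} (hν : 0 < ν) (n m : ℕ) :
    ∫ t : ℝ, mpPoly ν 0 n (Complex.I * t) * (starRingEnd ℂ) (mpPoly ν 0 m (Complex.I * t))
      ∂mpMeasure ν = if n = m then (mpNormSq ν n : ℂ) else 0 := by
  rcases le_total m n with h | h
  · exact integral_mpPoly_mul_conj_of_le hν h
  · have := congrArg (starRingEnd ℂ) (integral_mpPoly_mul_conj_of_le hν h)
    rw [← integral_conj] at this
    simp only [map_mul, Complex.conj_conj] at this
    simp_rw [mul_comm (mpPoly ν 0 n _)]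
    rw [this]
    by_cases hnm : n = m
    · subst hnm; simp
    · simp [hnm, Ne.symm hnm]

lemma integral_norm_sq_mpPoly {ν : ℝ} (hν : 0 < ν) (n : ℕ) :
    ∫ t : ℝ, ‖mpPoly ν 0 n (Complex.I * t)‖ ^ 2 ∂mpMeasure ν = mpNormSq ν n := by
  have h := integral_mpPoly_mul_conj hν n n
  simp_rw [Complex.mul_conj, Complex.normSq_eq_norm_sq] at h
  simp only [integral_complex_ofReal, if_true] at h
  exact_mod_cast h

lemma mpCoeff_eq {ν : ℝ} (hν : 0 < ν) (f : ℂ → ℂ) (n : ℕ) :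
    mpCoeff ν f n = (∫ t : ℝ, f (Complex.I * t) *
      (starRingEnd ℂ) (mpPoly ν 0 n (Complex.I * t)) ∂mpMeasure ν) / (mpNormSq ν n : ℂ) := by
  rw [mpCoeff, integral_norm_sq_mpPoly hν]

/-! ### The difference operator: eigenfunctions and symmetry -/

/-- The difference operator having the Meixner-Pollaczek polynomials as eigenfunctions. -/
def mpOp (ν : ℝ) (h : ℂ → ℂ) (s : ℂ) : ℂ :=
  2⁻¹ * (((ν : ℂ) / 2 + s) * h (s + 1) + ((ν : ℂ) / 2 - s) * h (s - 1))

lemma mpOp_neg (ν : ℝ) (h : ℂ → ℂ) (s : ℂ) :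
    mpOp ν (fun z => h (-z)) s = mpOp ν h (-s) := by
  simp only [mpOp]
  rw [show -(s + 1) = -s - 1 by ring, show -(s - 1) = -s + 1 by ring]
  ring

/-- In the basis (s+ν/2)_k the operator is bidiagonal with diagonal entries k + ν/2, so an
eigenvalue equation is a two-term recursion for coefficients (`mpPolyCoeff_succ` for the eigenvalue
n + ν/2). At k = 0 the truncated index k - 1 is harmless, its coefficient being zero. -/
lemma mpOp_ascPochhammer (ν : ℝ) (k : ℕ) (s : ℂ) :
    mpOp ν (fun s => (ascPochhammer ℂ k).eval (s + (ν : ℂ) / 2)) s =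
      (k + (ν : ℂ) / 2) * (ascPochhammer ℂ k).eval (s + (ν : ℂ) / 2) -
        k * (k + ν - 1) / 2 * (ascPochhammer ℂ (k - 1)).eval (s + (ν : ℂ) / 2) := by
  have hl : ∀ (j : ℕ) (b : ℂ), (ascPochhammer ℂ (j + 1)).eval b =
      b * (ascPochhammer ℂ j).eval (b + 1) := fun j b => by
    rw [ascPochhammer_succ_left]; simp
  cases k with
  | zero => simp [mpOp]; ring
  | succ j =>
    have h1 := hl (j + 1) (s + (ν : ℂ) / 2)
    have h2 := hl j (s - 1 + (ν : ℂ) / 2)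
    rw [ascPochhammer_succ_eval, ascPochhammer_succ_eval] at h1
    rw [show s - 1 + (ν : ℂ) / 2 + 1 = s + (ν : ℂ) / 2 by ring] at h2
    rw [show s + (ν : ℂ) / 2 + 1 = s + 1 + (ν : ℂ) / 2 by ring] at h1
    rw [mpOp, h2, ascPochhammer_succ_eval _ (s + (ν : ℂ) / 2), Nat.add_sub_cancel]
    push_cast at h1 ⊢
    linear_combination (-2⁻¹) * h1

lemma mpPolyCoeff_succ {ν : ℝ} (hν : 0 < ν) {n k : ℕ} (hk : k ≤ n) :
    mpPolyCoeff ν n (k + 1) * ((k + 1) * (k + ν)) = -2 * (n - k) * mpPolyCoeff ν n k := by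
  have h := Nat.choose_succ_right_eq n k
  have h' : (n.choose (k + 1) : ℝ) * (k + 1) = n.choose k * (n - k) := by
    rw [← Nat.cast_sub hk]; exact_mod_cast h
  have h1 := (ascPochhammer_pos k ν hν).ne'
  have h2 : ν + k ≠ 0 := by positivity
  rw [mpPolyCoeff, mpPolyCoeff, ascPochhammer_succ_eval]
  field_simp
  rw [pow_succ]
  linear_combination (-2) ^ k * (-2) * mpNormSq ν n * (ν + k) * h'

lemma mpOp_mpPoly {ν : ℝ} (hν : 0 < ν) (n : ℕ) (s : ℂ) :
    mpOp ν (mpPoly ν 0 n) s = (n + (ν : ℂ) / 2) * mpPoly ν 0 n s := by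
  set P : ℕ → ℂ := fun k => (ascPochhammer ℂ k).eval (s + (ν : ℂ) / 2)
  have h1 : mpOp ν (mpPoly ν 0 n) s = ∑ k ∈ Finset.range (n + 1), (mpPolyCoeff ν n k : ℂ) *
      ((k + (ν : ℂ) / 2) * P k - k * (k + ν - 1) / 2 * P (k - 1)) := by
    simp only [P, ← mpOp_ascPochhammer]
    simp only [mpOp, mpPoly_eq_sum, Finset.mul_sum, ← Finset.sum_add_distrib]
    refine Finset.sum_congr rfl fun k _ => by ring
  -- The term k = n of the first sum and the term k = 0 of the second vanish; after shifting the
  -- index of the second sum, the rest cancels termwise by the recursion.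
  have h2 : ∑ k ∈ Finset.range (n + 1), (mpPolyCoeff ν n k : ℂ) * ((n - k) * P k) +
      ∑ k ∈ Finset.range (n + 1), (mpPolyCoeff ν n k : ℂ) * (k * (k + ν - 1) / 2 * P (k - 1)) = 0 := by
    rw [Finset.sum_range_succ, Finset.sum_range_succ', sub_self, Nat.cast_zero]
    simp only [zero_mul, mul_zero, zero_div, add_zero]
    rw [← Finset.sum_add_distrib]
    refine Finset.sum_eq_zero fun k hk => ?_
    have := mpPolyCoeff_succ hν (Finset.mem_range.1 hk).le
    have hc : (mpPolyCoeff ν n (k + 1) : ℂ) * ((k + 1) * (k + ν)) =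
      -2 * (n - k) * mpPolyCoeff ν n k := by exact_mod_cast this
    rw [Nat.add_sub_cancel]
    push_cast
    linear_combination (P k / 2) * hc
  rw [h1, mpPoly_eq_sum, Finset.mul_sum, ← sub_eq_zero, ← Finset.sum_sub_distrib]
  rw [← Finset.sum_add_distrib] at h2
  rw [← neg_eq_zero, ← h2, ← Finset.sum_neg_distrib]
  exact Finset.sum_congr rfl fun k _ => by ring

lemma mpDensity_neg (ν t : ℝ) : mpDensity ν (-t) = mpDensity ν t := by
  have h1 := ofReal_mpDensity ν t
  have h2 := ofReal_mpDensity ν (-t)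
  push_cast at h1 h2
  rw [mul_neg, ← sub_eq_add_neg, sub_neg_eq_add, mul_comm (Complex.Gamma _), ← h1] at h2
  exact_mod_cast h2

lemma integral_mpMeasure_comp_neg {ν : ℝ} (hν : 0 < ν) (g : ℝ → ℂ) :
    ∫ t, g (-t) ∂mpMeasure ν = ∫ t, g t ∂mpMeasure ν := by
  rw [integral_mpMeasure hν, integral_mpMeasure hν,
    ← integral_neg_eq_self (fun t => mpDensity ν t • g t)]
  simp_rw [mpDensity_neg]

lemma differentiableAt_Gamma_of_re_pos {s : ℂ} (hs : 0 < s.re) :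
    DifferentiableAt ℂ Complex.Gamma s := by
  refine Complex.differentiableAt_Gamma s fun m hm => ?_
  have : (0 : ℝ) ≤ m := m.cast_nonneg
  rw [hm] at hs
  simp at hs
  linarith

/-- By Γ(z+1) = zΓ(z) both sides are, up to the same constant, integrals of F(s) = h(s) g(s-1)
Γ(ν/2+s) Γ(ν/2+1-s), along Re s = 1 and Re s = 0. Between these lines both Γ-arguments have real
part at least ν/2 > 0, so no pole is crossed. -/
lemma integral_shift_mul {ν K r r' : ℝ} {h g : ℂ → ℂ} (hν : 0 < ν)
    (H : ExpBoundedOnStrip K r h) (G : ExpBoundedOnStrip K r' g) (hK : 1 < K)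
    (hr : r + r' < Real.pi) :
    ∫ t : ℝ, ((ν : ℂ) / 2 + Complex.I * t) * h (Complex.I * t + 1) * g (Complex.I * t)
      ∂mpMeasure ν =
    ∫ t : ℝ, h (Complex.I * t) * (((ν : ℂ) / 2 - Complex.I * t) * g (Complex.I * t - 1))
      ∂mpMeasure ν := by
  set F : ℂ → ℂ := fun s => h s * g (s - 1) *
    (Complex.Gamma ((ν : ℂ) / 2 + s) * Complex.Gamma ((ν : ℂ) / 2 + 1 - s)) with hF
  obtain ⟨θ, h1, h2⟩ := exists_between (max_lt hr Real.pi_pos)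
  have hθ0 : 0 < θ := lt_of_le_of_lt (le_max_right _ _) h1
  have hθr : 0 < θ - (r + r') := by linarith [le_max_left (r + r') 0]
  obtain ⟨C, hC0, hC⟩ := H.exists_bound
  obtain ⟨C', hC0', hC'⟩ := G.exists_bound
  obtain ⟨D, hD0, hD⟩ := exists_norm_Gamma_le (a := ν / 2) (b := ν / 2 + 1) (θ := θ / 2)
    (half_pos hν) (by linarith) (by linarith)
  have hs0 : ∀ s : ℂ, 0 ≤ s.re → s.re ≤ 1 → |s.re| < K := fun s h0 h1 => by
    rw [abs_of_nonneg h0]; linarith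
  have hs1 : ∀ s : ℂ, 0 ≤ s.re → s.re ≤ 1 → |(s - 1).re| < K := fun s h0 h1 => by
    rw [Complex.sub_re, Complex.one_re, abs_of_nonpos (by linarith)]; linarith
  have hshift := integral_vertical_shift (G := F) (C := C * C' * (D * D)) (c := θ - (r + r')) hθr ?_ ?_
  · rw [integral_mpMeasure hν, integral_mpMeasure hν]
    have e1 : ∀ t : ℝ, mpDensity ν t • (((ν : ℂ) / 2 + Complex.I * t) * h (Complex.I * t + 1) *
        g (Complex.I * t)) = ((1 / (2 * Real.pi) * ((2 : ℝ) ^ ν / Real.Gamma ν) : ℝ) : ℂ) *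
          F (Complex.I * t + 1) := by
      intro t
      have hne : (ν : ℂ) / 2 + Complex.I * t ≠ 0 := fun h => by
        have := congrArg Complex.re h
        simp at this
        linarith
      have hΓ := Complex.Gamma_add_one _ hne
      rw [Complex.real_smul, ofReal_mpDensity, hF]
      simp only
      rw [show (ν : ℂ) / 2 + (Complex.I * t + 1) = (ν : ℂ) / 2 + Complex.I * t + 1 by ring, hΓ,
        show (ν : ℂ) / 2 + 1 - (Complex.I * t + 1) = (ν : ℂ) / 2 - Complex.I * t by ring,
        add_sub_cancel_right]
      push_cast
      ring
    have e2 : ∀ t : ℝ, mpDensity ν t • (h (Complex.I * t) * (((ν : ℂ) / 2 - Complex.I * t) *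
        g (Complex.I * t - 1))) = ((1 / (2 * Real.pi) * ((2 : ℝ) ^ ν / Real.Gamma ν) : ℝ) : ℂ) *
          F (Complex.I * t) := by
      intro t
      have hne : (ν : ℂ) / 2 - Complex.I * t ≠ 0 := fun h => by
        have := congrArg Complex.re h
        simp at this
        linarith
      have hΓ := Complex.Gamma_add_one _ hne
      rw [Complex.real_smul, ofReal_mpDensity, hF]
      simp only
      rw [show (ν : ℂ) / 2 + 1 - Complex.I * t = (ν : ℂ) / 2 - Complex.I * t + 1 by ring, hΓ]
      push_cast
      ring
    simp_rw [e1, e2]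
    rw [integral_const_mul, integral_const_mul, hshift]
  · intro s h0 h1
    refine ((H.1 s (hs0 s h0 h1)).mul ?_).mul (DifferentiableAt.mul ?_ ?_)
    · exact DifferentiableAt.comp (g := g) (f := fun s : ℂ => s - 1) s (G.1 _ (hs1 s h0 h1))
        (by fun_prop)
    · refine DifferentiableAt.comp (g := Complex.Gamma) (f := fun s : ℂ => (ν : ℂ) / 2 + s) s
        (differentiableAt_Gamma_of_re_pos ?_) (by fun_prop)
      simp; linarith
    · refine DifferentiableAt.comp (g := Complex.Gamma) (f := fun s : ℂ => (ν : ℂ) / 2 + 1 - s) s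
        (differentiableAt_Gamma_of_re_pos ?_) (by fun_prop)
      simp; linarith
  · intro s h0 h1
    have b1 := hC s (hs0 s h0 h1)
    have b2 := hC' _ (hs1 s h0 h1)
    have b3 := hD ((ν : ℂ) / 2 + s) (by simpa) (by simpa)
    have b4 := hD ((ν : ℂ) / 2 + 1 - s) (by simp; linarith) (by simp; linarith)
    simp only [Complex.sub_im, Complex.one_im, sub_zero] at b2
    simp only [Complex.add_im, Complex.sub_im, Complex.one_im, Complex.div_ofNat_im,
      Complex.ofReal_im, zero_div, zero_add, add_zero, zero_sub, abs_neg] at b3 b4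
    have e : Real.exp (-(θ - (r + r')) * |s.im|) = Real.exp (r * |s.im|) * Real.exp (r' * |s.im|) *
        (Real.exp (-(θ / 2) * |s.im|) * Real.exp (-(θ / 2) * |s.im|)) := by
      simp only [← Real.exp_add]; ring_nf
    calc ‖F s‖ = ‖h s‖ * ‖g (s - 1)‖ * (‖Complex.Gamma ((ν : ℂ) / 2 + s)‖ *
          ‖Complex.Gamma ((ν : ℂ) / 2 + 1 - s)‖) := by simp only [hF, norm_mul]
      _ ≤ (C * Real.exp (r * |s.im|)) * (C' * Real.exp (r' * |s.im|)) *
          ((D * Real.exp (-(θ / 2) * |s.im|)) * (D * Real.exp (-(θ / 2) * |s.im|))) := by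
        gcongr
      _ = _ := by rw [e]; ring

lemma ExpBoundedOnStrip.mpOp_left {ν K r r' : ℝ} {h : ℂ → ℂ} (H : ExpBoundedOnStrip K r h)
    (hr : r < r') : ExpBoundedOnStrip (K - 1) r'
      (fun s => ((ν : ℂ) / 2 + s) * h (s + 1)) := by
  have h0 : 0 < r' - r := by linarith
  have := ((const (K - 1) h0.le ((ν : ℂ) / 2)).add (id (K - 1) h0)).mul
    (H.shift (c := 1) (by simp))
  simpa using this

lemma ExpBoundedOnStrip.mpOp_right {ν K r r' : ℝ} {h : ℂ → ℂ} (H : ExpBoundedOnStrip K r h)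
    (hr : r < r') : ExpBoundedOnStrip (K - 1) r'
      (fun s => ((ν : ℂ) / 2 - s) * h (s - 1)) := by
  have h0 : 0 < r' - r := by linarith
  have := ((const (K - 1) h0.le ((ν : ℂ) / 2)).add (id (K - 1) h0).neg).mul
    (H.shift (c := -1) (by simp))
  simpa [sub_eq_add_neg] using this

lemma ExpBoundedOnStrip.mpOp {ν K r r' : ℝ} {h : ℂ → ℂ} (H : ExpBoundedOnStrip K r h)
    (hr : r < r') : ExpBoundedOnStrip (K - 1) r' (mpOp ν h) := by
  have := (const (K - 1) le_rfl 2⁻¹).mul ((H.mpOp_left (ν := ν) hr).add (H.mpOp_right (ν := ν) hr))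
  rwa [zero_add] at this

/-- A contour shift turns the upward shift of h into the downward shift of g. The other half is the
same identity after s ↦ -s, under which M_ν is invariant. -/
lemma integral_mpOp_mul {ν K r r' : ℝ} {h g : ℂ → ℂ} (hν : 0 < ν)
    (H : ExpBoundedOnStrip K r h) (G : ExpBoundedOnStrip K r' g) (hK : 1 < K)
    (hr : r + r' < Real.pi) :
    ∫ t : ℝ, mpOp ν h (Complex.I * t) * g (Complex.I * t) ∂mpMeasure ν =
    ∫ t : ℝ, h (Complex.I * t) * mpOp ν g (Complex.I * t) ∂mpMeasure ν := by
  -- The linear factors in `mpOp` raise the growth rate by an arbitrarily small ε, for which there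
  -- is room below π.
  obtain ⟨ε, hε0, hε⟩ : ∃ ε > 0, r + r' + ε < Real.pi :=
    ⟨(Real.pi - (r + r')) / 2, by linarith, by linarith⟩
  have hK1 : 0 < K - 1 := by linarith
  have hr1 : r < r + ε := by linarith
  have hr2 : r' < r' + ε := by linarith
  have G' := G.mono (by linarith : K - 1 ≤ K) le_rfl
  have H' := H.mono (by linarith : K - 1 ≤ K) le_rfl
  have i1 := ((H.mpOp_left (ν := ν) hr1).mul G').integrable hν hK1 (by linarith)
  have i2 := ((H.mpOp_right (ν := ν) hr1).mul G').integrable hν hK1 (by linarith)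
  have i3 := (H'.mul (G.mpOp_left (ν := ν) hr2)).integrable hν hK1 (by linarith)
  have i4 := (H'.mul (G.mpOp_right (ν := ν) hr2)).integrable hν hK1 (by linarith)
  have s1 := integral_shift_mul hν H G hK hr
  have s2 := integral_shift_mul hν H.neg G.neg hK hr
  have s3 : ∫ t : ℝ, ((ν : ℂ) / 2 - Complex.I * t) * h (Complex.I * t - 1) * g (Complex.I * t)
      ∂mpMeasure ν = ∫ t : ℝ, h (Complex.I * t) * (((ν : ℂ) / 2 + Complex.I * t) *
        g (Complex.I * t + 1)) ∂mpMeasure ν := by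
    rw [← integral_mpMeasure_comp_neg hν, ← integral_mpMeasure_comp_neg hν
      (fun t : ℝ => h (Complex.I * t) * _)]
    convert s2 using 3 with t t <;> push_cast <;> ring_nf
  have e1 : ∀ t : ℝ, mpOp ν h (Complex.I * t) * g (Complex.I * t) =
      2⁻¹ * (((ν : ℂ) / 2 + Complex.I * t) * h (Complex.I * t + 1) * g (Complex.I * t)) +
      2⁻¹ * (((ν : ℂ) / 2 - Complex.I * t) * h (Complex.I * t - 1) * g (Complex.I * t)) :=
    fun t => by rw [mpOp]; ring
  have e2 : ∀ t : ℝ, h (Complex.I * t) * mpOp ν g (Complex.I * t) =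
      2⁻¹ * (h (Complex.I * t) * (((ν : ℂ) / 2 + Complex.I * t) * g (Complex.I * t + 1))) +
      2⁻¹ * (h (Complex.I * t) * (((ν : ℂ) / 2 - Complex.I * t) * g (Complex.I * t - 1))) :=
    fun t => by rw [mpOp]; ring
  simp_rw [e1, e2]
  rw [integral_add (i1.const_mul _) (i2.const_mul _), integral_add (i3.const_mul _) (i4.const_mul _)]
  simp only [integral_const_mul]
  rw [s1, s3, add_comm]

lemma mpCoeff_mpOp {ν K r : ℝ} {h : ℂ → ℂ} (hν : 0 < ν) (H : ExpBoundedOnStrip K r h)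
    (hK : 1 < K) (hr : r < Real.pi / 2) (n : ℕ) :
    mpCoeff ν (mpOp ν h) n = (n + ν / 2 : ℝ) * mpCoeff ν h n := by
  rw [mpCoeff_eq hν, mpCoeff_eq hν, ← mul_div_assoc]
  congr 1
  simp_rw [conj_mpPoly]
  have := integral_mpOp_mul hν H (ExpBoundedOnStrip.mpPoly ν K n one_pos).neg hK
    (by linarith [Real.pi_gt_three])
  rw [this, ← integral_const_mul]
  congr 1
  ext t
  rw [mpOp_neg, mpOp_mpPoly hν]
  push_cast
  ring

/-- The function g is `mpOp` applied k times to h. Each application costs one unit of the half-width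
and an arbitrarily small part of the gap between r and r'. -/
lemma exists_mpCoeff_eq_pow_mul {ν : ℝ} (hν : 0 < ν) (k : ℕ) : ∀ {K r r' : ℝ} {h : ℂ → ℂ},
    ExpBoundedOnStrip K r h → (k : ℝ) < K → r < r' → r' < Real.pi / 2 →
    ∃ g, ExpBoundedOnStrip (K - k) r' g ∧
      ∀ n, mpCoeff ν g n = ((n + ν / 2 : ℝ) : ℂ) ^ k * mpCoeff ν h n := by
  induction k with
  | zero =>
    intro K r r' h H _ hr _
    exact ⟨h, H.mono (by simp) hr.le, fun n => by simp⟩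
  | succ k ih =>
    intro K r r' h H hk hr hr'
    obtain ⟨r1, h1, h2⟩ := exists_between hr
    push_cast at hk
    have hk0 : (0 : ℝ) ≤ k := k.cast_nonneg
    obtain ⟨g, hg, hgc⟩ := ih (H.mpOp (ν := ν) h1) (by linarith) h2 hr'
    refine ⟨g, hg.mono (by push_cast; linarith) le_rfl, fun n => ?_⟩
    rw [hgc, mpCoeff_mpOp hν H (by linarith) (by linarith)]
    ring

/-! ### Decay of the coefficients of a holomorphic function -/

lemma norm_mpCoeff_le {ν : ℝ} (hν : 0 < ν) {f : ℂ → ℂ}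
    (hf : MemLp (fun t : ℝ => f (Complex.I * t)) 2 (mpMeasure ν)) (n : ℕ) :
    ‖mpCoeff ν f n‖ ≤ (∫ t : ℝ, ‖f (Complex.I * t)‖ ^ 2 ∂mpMeasure ν) ^ (1 / 2 : ℝ) *
      (mpNormSq ν n)⁻¹ ^ (1 / 2 : ℝ) := by
  have hpos := mpNormSq_pos hν n
  have hq := memLp_mpPoly hν n
  have hCS := integral_mul_le_Lp_mul_Lq_of_nonneg (μ := mpMeasure ν) Real.HolderConjugate.two_two
    (f := fun t : ℝ => ‖f (Complex.I * t)‖) (g := fun t : ℝ => ‖mpPoly ν 0 n (Complex.I * t)‖)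
    (Eventually.of_forall fun t => norm_nonneg _) (Eventually.of_forall fun t => norm_nonneg _)
    (by simpa using hf.norm) (by simpa using hq.norm)
  simp only [Real.rpow_two] at hCS
  rw [integral_norm_sq_mpPoly hν] at hCS
  have h1 : ‖∫ t : ℝ, f (Complex.I * t) * (starRingEnd ℂ) (mpPoly ν 0 n (Complex.I * t))
      ∂mpMeasure ν‖ ≤ ∫ t : ℝ, ‖f (Complex.I * t)‖ * ‖mpPoly ν 0 n (Complex.I * t)‖ ∂mpMeasure ν := by
    refine (norm_integral_le_integral_norm _).trans (le_of_eq ?_)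
    simp only [norm_mul, RCLike.norm_conj]
  rw [mpCoeff_eq hν, norm_div, Complex.norm_real, Real.norm_of_nonneg hpos.le, div_le_iff₀ hpos]
  refine (h1.trans hCS).trans (le_of_eq ?_)
  rw [mul_assoc, Real.inv_rpow hpos.le]
  congr 1
  rw [inv_mul_eq_div, eq_div_iff (Real.rpow_pos_of_pos hpos _).ne', ← Real.rpow_add hpos]
  norm_num

/-- For n ≥ 1, n!/(ν)_n is Euler's sequence for Γ(ν) times (ν+n) n^{-ν}, and Euler's sequence
converges. -/
lemma inv_mpNormSq_isBigO {ν : ℝ} (hν : 0 < ν) :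
    (fun n : ℕ => (mpNormSq ν n)⁻¹) =O[atTop] fun n : ℕ => (n : ℝ) ^ (1 - ν) := by
  have hp : ∀ n : ℕ, ∏ j ∈ Finset.range n, (ν + j) = (ascPochhammer ℝ n).eval ν := by
    intro n
    induction n with
    | zero => simp
    | succ n ih => rw [Finset.prod_range_succ, ih, ascPochhammer_succ_eval]
  have h1 : (fun n : ℕ => Real.GammaSeq ν n) =O[atTop] fun _ => (1 : ℝ) :=
    (Real.GammaSeq_tendsto_Gamma ν).isBigO_one ℝ
  have h2 : (fun n : ℕ => (ν + n) * (n : ℝ) ^ (-ν)) =O[atTop] fun n : ℕ => (n : ℝ) ^ (1 - ν) := by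
    refine IsBigO.of_bound (ν + 1) ?_
    filter_upwards [eventually_ge_atTop 1] with n hn
    have hn1 : (1 : ℝ) ≤ n := by exact_mod_cast hn
    rw [sub_eq_add_neg, Real.rpow_add (by linarith), Real.rpow_one, norm_mul, norm_mul, ← mul_assoc]
    gcongr
    rw [Real.norm_of_nonneg (by positivity), Real.norm_of_nonneg (by positivity)]
    nlinarith
  refine (h1.mul h2).congr' ?_ (Eventually.of_forall fun n => one_mul _)
  filter_upwards [eventually_ge_atTop 1] with n hn
  have hn1 : (0 : ℝ) < n := by exact_mod_cast hn
  have h3 := (ascPochhammer_pos n ν hν).ne'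
  have h4 : (n : ℝ) ^ ν ≠ 0 := (Real.rpow_pos_of_pos hn1 ν).ne'
  have h5 : ν + n ≠ 0 := by positivity
  rw [Real.GammaSeq, hp, ascPochhammer_succ_eval, mpNormSq, Real.rpow_neg hn1.le]
  field_simp

lemma isLittleO_natCast_rpow {a b : ℝ} (hab : a < b) :
    (fun n : ℕ => (n : ℝ) ^ a) =o[atTop] fun n : ℕ => (n : ℝ) ^ b := by
  refine isLittleO_of_tendsto' ?_ ?_
  · filter_upwards [eventually_ge_atTop 1] with n hn h
    have hn1 : (0 : ℝ) < n := by exact_mod_cast hn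
    exact absurd h (Real.rpow_pos_of_pos hn1 b).ne'
  · refine ((tendsto_rpow_neg_atTop (sub_pos.2 hab)).comp tendsto_natCast_atTop_atTop).congr' ?_
    filter_upwards [eventually_ge_atTop 1] with n hn
    have hn1 : (0 : ℝ) < n := by exact_mod_cast hn
    rw [Function.comp_apply, neg_sub, Real.rpow_sub hn1]

/-- Decay of the coefficients of a function holomorphic in a symmetric strip. -/
lemma ExpBoundedOnStrip.mpCoeff_isLittleO {ν K K' r : ℝ} {h : ℂ → ℂ} (hν : 0 < ν)
    (H : ExpBoundedOnStrip K' r h) (hK : 0 ≤ K) (hKK' : K + 2 ≤ K') (hr : r < Real.pi / 2) :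
    mpCoeff ν h =o[atTop] fun n : ℕ => (n : ℝ) ^ (-K - ν / 2) := by
  obtain ⟨r', h1, h2⟩ := exists_between hr
  -- k ≥ K + 1 brings the exponent -k + (1-ν)/2 down to at most -K - ν/2 - 1/2, and k < K + 2 ≤ K'
  -- leaves a strip of positive width after k applications of the operator.
  set k := ⌈K + 1⌉₊
  have hk1 : K + 1 ≤ k := Nat.le_ceil _
  have hk2 : (k : ℝ) < K + 1 + 1 := Nat.ceil_lt_add_one (by linarith)
  obtain ⟨g, hg, hgc⟩ := exists_mpCoeff_eq_pow_mul hν k H (by linarith) h1 h2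
  have hg2 := hg.memLp hν (by linarith) h2
  have hO : mpCoeff ν g =O[atTop] fun n : ℕ => (n : ℝ) ^ ((1 - ν) / 2) := by
    have h3 : (fun n : ℕ => (mpNormSq ν n)⁻¹ ^ (1 / 2 : ℝ)) =O[atTop]
        fun n : ℕ => ((n : ℝ) ^ (1 - ν)) ^ (1 / 2 : ℝ) :=
      (inv_mpNormSq_isBigO hν).rpow (by norm_num) (Eventually.of_forall fun n => by positivity)
    refine (IsBigO.trans (IsBigO.of_bound
      ((∫ t : ℝ, ‖g (Complex.I * t)‖ ^ 2 ∂mpMeasure ν) ^ (1 / 2 : ℝ)) (.of_forall fun n => ?_))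
      h3).congr_right fun n => ?_
    · rw [Real.norm_of_nonneg (Real.rpow_nonneg (inv_nonneg.2 (mpNormSq_pos hν n).le) _)]
      exact norm_mpCoeff_le hν hg2 n
    · rw [← Real.rpow_mul n.cast_nonneg]; ring_nf
  have hO2 : mpCoeff ν h =O[atTop] fun n : ℕ => (n : ℝ) ^ (-K - ν / 2 - 1 / 2) := by
    obtain ⟨C, hC⟩ := hO.bound
    refine IsBigO.of_bound C ?_
    filter_upwards [hC, eventually_ge_atTop 1] with n hn hn1
    have hn1 : (1 : ℝ) ≤ n := by exact_mod_cast hn1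
    have hn0 : (0 : ℝ) < n := by linarith
    rw [hgc, norm_mul, norm_pow, Complex.norm_real, Real.norm_of_nonneg (by positivity),
      Real.norm_of_nonneg (by positivity)] at hn
    rw [Real.norm_of_nonneg (by positivity)]
    have hpow : (n : ℝ) ^ (k : ℝ) * ‖mpCoeff ν h n‖ ≤ C * (n : ℝ) ^ ((1 - ν) / 2) := by
      rw [Real.rpow_natCast]
      refine le_trans ?_ hn
      gcongr
      linarith
    have hC0 : 0 ≤ C := by
      by_contra hC0
      have : C * (n : ℝ) ^ ((1 - ν) / 2) < 0 :=
        mul_neg_of_neg_of_pos (not_le.1 hC0) (by positivity)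
      have : 0 ≤ (n : ℝ) ^ (k : ℝ) * ‖mpCoeff ν h n‖ := by positivity
      linarith
    calc ‖mpCoeff ν h n‖ = (n : ℝ) ^ (-(k : ℝ)) * ((n : ℝ) ^ (k : ℝ) * ‖mpCoeff ν h n‖) := by
          rw [← mul_assoc, ← Real.rpow_add hn0]; simp
      _ ≤ (n : ℝ) ^ (-(k : ℝ)) * (C * (n : ℝ) ^ ((1 - ν) / 2)) := by gcongr
      _ = C * (n : ℝ) ^ (-(k : ℝ) + (1 - ν) / 2) := by rw [Real.rpow_add hn0]; ring
      _ ≤ C * (n : ℝ) ^ (-K - ν / 2 - 1 / 2) := by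
          gcongr
          linarith
  exact hO2.trans_isLittleO (isLittleO_natCast_rpow (by linarith))

/-! ### Coefficients of a simple fraction -/

lemma cayley_pos {x : ℝ} (hx : x ∈ Set.Ioo (-1 : ℝ) 1) : 0 < (1 - x) / (1 + x) :=
  div_pos (by linarith [hx.2]) (by linarith [hx.1])

lemma Ioo_zero_one_subset {x : ℝ} (hx : x ∈ Set.Ioo (0 : ℝ) 1) : x ∈ Set.Ioo (-1 : ℝ) 1 :=
  ⟨by linarith [hx.1], hx.2⟩

/-- The map x ↦ (1-x)/(1+x) is an involution, so evaluating the Fourier transform of q_n at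
(1-x)/(1+x) turns its n-th power into x^n. -/
lemma integral_cayley_cpow_mul_conj_mpPoly {ν x : ℝ} (hν : 0 < ν) (hx : x ∈ Set.Ioo (-1 : ℝ) 1)
    (n : ℕ) :
    ∫ t : ℝ, (((1 - x) / (1 + x) : ℝ) : ℂ) ^ (Complex.I * t) *
      (starRingEnd ℂ) (mpPoly ν 0 n (Complex.I * t)) ∂mpMeasure ν =
    ((mpNormSq ν n * ((1 - x) ^ (ν / 2) * (1 + x) ^ (ν / 2) * x ^ n) : ℝ) : ℂ) := by
  have h1 : 0 < 1 - x := by linarith [hx.2]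
  have h2 : 0 < 1 + x := by linarith [hx.1]
  rw [integral_cpow_mul_conj_mpPoly hν (cayley_pos hx)]
  have e1 : 1 + (1 - x) / (1 + x) = 2 / (1 + x) := by field_simp; ring
  have e2 : (1 - (1 - x) / (1 + x)) / (2 / (1 + x)) = x := by field_simp; ring
  rw [e1, e2, Real.rpow_neg (by positivity), Real.div_rpow two_pos.le h2.le, Real.div_rpow h1.le h2.le]
  have h3 : (1 + x) ^ ν = (1 + x) ^ (ν / 2) * (1 + x) ^ (ν / 2) := by
    rw [← Real.rpow_add h2, add_halves]
  have h4 := (Real.rpow_pos_of_pos two_pos ν).ne'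
  have h5 := (Real.rpow_pos_of_pos h2 (ν / 2)).ne'
  rw [h3]
  congr 1
  field_simp

lemma intervalIntegrable_one_sub_rpow {c : ℝ} (hc : 0 < c) :
    IntervalIntegrable (fun x : ℝ => (1 - x) ^ (c - 1)) volume 0 1 := by
  have := (intervalIntegral.intervalIntegrable_rpow' (a := 1) (b := 0) (r := c - 1)
    (by linarith)).comp_sub_left 1
  simpa using this

lemma norm_cayley_cpow_mul {x : ℝ} (hx : x ∈ Set.Ioo (0 : ℝ) 1) (a : ℂ) :
    ‖(((1 - x) / (1 + x) : ℝ) : ℂ) ^ a * ((2 / (1 - x ^ 2) : ℝ) : ℂ)‖ =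
      2 * (1 - x) ^ (a.re - 1) * (1 + x) ^ (-a.re - 1) := by
  have h1 : 0 < 1 - x := by linarith [hx.2]
  have h2 : 0 < 1 + x := by linarith [hx.1]
  have h3 : 1 - x ^ 2 = (1 - x) * (1 + x) := by ring
  rw [norm_mul, Complex.norm_cpow_eq_rpow_re_of_pos (by positivity), Complex.norm_real, h3,
    Real.norm_of_nonneg (by positivity), Real.div_rpow h1.le h2.le, Real.rpow_sub h1,
    Real.rpow_sub h2, Real.rpow_neg h2.le]
  simp only [Real.rpow_one]
  field_simp

lemma integrableOn_cayley_cpow_mul {a : ℂ} (ha : 0 < a.re) :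
    IntegrableOn (fun x : ℝ => (((1 - x) / (1 + x) : ℝ) : ℂ) ^ a * ((2 / (1 - x ^ 2) : ℝ) : ℂ))
      (Set.Ioo 0 1) := by
  have h := ((intervalIntegrable_iff_integrableOn_Ioo_of_le zero_le_one).1
    (intervalIntegrable_one_sub_rpow ha)).const_mul 2
  refine Integrable.mono' h ?_ ?_
  · refine Measurable.aestronglyMeasurable ?_
    exact (Measurable.pow_const (Complex.measurable_ofReal.comp (by fun_prop)) a).mul
      (Complex.measurable_ofReal.comp (by fun_prop))
  · refine (ae_restrict_iff' measurableSet_Ioo).2 (Eventually.of_forall fun x hx => ?_)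
    rw [norm_cayley_cpow_mul hx]
    have h1 : 0 < 1 - x := by linarith [hx.2]
    have : (1 + x) ^ (-a.re - 1) ≤ 1 :=
      Real.rpow_le_one_of_one_le_of_nonpos (by linarith [hx.1]) (by linarith)
    exact mul_le_of_le_one_right (by positivity) this

/-- With w = (1-x)/(1+x) the weight 2dx/(1-x²) is -dw/w, so -w^a/a is an antiderivative. Used with a
= εs + σ, this writes a simple fraction as a superposition of powers of w. -/
lemma integral_cayley_cpow {a : ℂ} (ha : 0 < a.re) :
    ∫ x in Set.Ioo (0 : ℝ) 1, (((1 - x) / (1 + x) : ℝ) : ℂ) ^ a * ((2 / (1 - x ^ 2) : ℝ) : ℂ) =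
      1 / a := by
  have ha0 : a ≠ 0 := fun h => by simp [h] at ha
  rw [← integral_Ioc_eq_integral_Ioo, ← intervalIntegral.integral_of_le zero_le_one]
  rw [intervalIntegral.integral_eq_sub_of_hasDerivAt_of_le zero_le_one
    (f := fun x : ℝ => -((((1 - x) / (1 + x) : ℝ) : ℂ) ^ a) / a)]
  · simp [ha0]
    ring
  · refine ContinuousOn.div_const (ContinuousOn.neg ?_) _
    refine (Complex.continuous_ofReal_cpow_const ha).comp_continuousOn ?_
    refine ContinuousOn.div (by fun_prop) (by fun_prop) fun x hx => ?_
    linarith [hx.1]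
  · intro x hx
    have h1 : 0 < 1 - x := by linarith [hx.2]
    have h2 : 0 < 1 + x := by linarith [hx.1]
    have hw := cayley_pos (Ioo_zero_one_subset hx)
    have hd : HasDerivAt (fun x : ℝ => (1 - x) / (1 + x)) (-2 / (1 + x) ^ 2) x := by
      have := ((hasDerivAt_id x).const_sub 1).div ((hasDerivAt_id x).const_add 1) h2.ne'
      refine this.congr_deriv ?_
      simp only [id]
      congr 1
      ring
    have := ((HasDerivAt.scomp x (hasDerivAt_ofReal_cpow_const hw.ne' ha0) hd).neg).div_const a
    refine this.congr_deriv ?_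
    have hwc : (((1 - x) / (1 + x) : ℝ) : ℂ) ≠ 0 := by exact_mod_cast hw.ne'
    rw [Complex.cpow_sub _ _ hwc, Complex.cpow_one, Complex.real_smul]
    have h3 : (2 / (1 - x ^ 2) : ℝ) = -(-2 / (1 + x) ^ 2) / ((1 - x) / (1 + x)) := by
      have : 1 - x ^ 2 ≠ 0 := by
        rw [show 1 - x ^ 2 = (1 - x) * (1 + x) by ring]; positivity
      field_simp
      ring
    rw [h3]
    generalize (1 - x) / (1 + x) = w at *
    push_cast
    field_simp
  · exact (intervalIntegrable_iff_integrableOn_Ioo_of_le zero_le_one).2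
      (integrableOn_cayley_cpow_mul ha)

/-- The integral representing the coefficients of a simple fraction. -/
def mpPoleIntegral (ν : ℝ) (σ : ℂ) (n : ℕ) : ℂ :=
  ∫ x : ℝ in (0 : ℝ)..1, 2 * (((1 - x : ℝ) : ℂ) ^ (σ + (ν : ℂ) / 2 - 1) *
    ((1 + x : ℝ) : ℂ) ^ (-σ + (ν : ℂ) / 2 - 1)) * (x : ℂ) ^ n

lemma mpPoleIntegral_integrand {ν x : ℝ} (σ : ℂ) (n : ℕ) (hx : x ∈ Set.Ioo (0 : ℝ) 1) :
    (((1 - x) / (1 + x) : ℝ) : ℂ) ^ σ * ((2 / (1 - x ^ 2) : ℝ) : ℂ) *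
      (((1 - x) ^ (ν / 2) * (1 + x) ^ (ν / 2) * x ^ n : ℝ) : ℂ) =
    2 * (((1 - x : ℝ) : ℂ) ^ (σ + (ν : ℂ) / 2 - 1) *
      ((1 + x : ℝ) : ℂ) ^ (-σ + (ν : ℂ) / 2 - 1)) * (x : ℂ) ^ n := by
  have h1 : 0 < 1 - x := by linarith [hx.2]
  have h2 : 0 < 1 + x := by linarith [hx.1]
  have h1' : ((1 - x : ℝ) : ℂ) ≠ 0 := by exact_mod_cast h1.ne'
  have h2' : ((1 + x : ℝ) : ℂ) ≠ 0 := by exact_mod_cast h2.ne'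
  have e : (((1 - x) / (1 + x) : ℝ) : ℂ) ^ σ = ((1 - x : ℝ) : ℂ) ^ σ * ((1 + x : ℝ) : ℂ) ^ (-σ) := by
    rw [div_eq_mul_inv, Complex.ofReal_mul, Complex.mul_cpow_ofReal_nonneg h1.le (by positivity),
      Complex.ofReal_inv, Complex.inv_cpow _ _ ?_, Complex.cpow_neg]
    rw [Complex.arg_ofReal_of_nonneg h2.le]
    exact Real.pi_ne_zero.symm
  rw [e, Complex.cpow_sub _ _ h1', Complex.cpow_sub _ _ h2', Complex.cpow_add _ _ h1',
    Complex.cpow_add _ _ h2', Complex.cpow_one, Complex.cpow_one,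
    show 1 - x ^ 2 = (1 - x) * (1 + x) by ring]
  have e1 : ((1 - x : ℝ) : ℂ) ^ ((ν : ℂ) / 2) = (((1 - x) ^ (ν / 2) : ℝ) : ℂ) := by
    rw [Complex.ofReal_cpow h1.le]; push_cast; rfl
  have e2 : ((1 + x : ℝ) : ℂ) ^ ((ν : ℂ) / 2) = (((1 + x) ^ (ν / 2) : ℝ) : ℂ) := by
    rw [Complex.ofReal_cpow h2.le]; push_cast; rfl
  rw [e1, e2]
  generalize 1 - x = u at *
  generalize 1 + x = v at *
  push_cast
  field_simp

/-- Insert the integral of w^{εs+σ} and exchange the integrals; the inner one is known. For ε = -1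
the power w^{-s} belongs to -x in place of x, which produces (-1)^n. -/
lemma mpCoeff_one_div {ν ε : ℝ} (hν : 0 < ν) (hε : ε = 1 ∨ ε = -1) {σ : ℂ} (hσ : 0 < σ.re) (n : ℕ) :
    mpCoeff ν (fun s => 1 / (ε * s + σ)) n = ε ^ n * mpPoleIntegral ν σ n := by
  have hN : (mpNormSq ν n : ℂ) ≠ 0 := by exact_mod_cast (mpNormSq_pos hν n).ne'
  have hfin := isFiniteMeasure_mpMeasure hν
  rw [mpCoeff_eq hν, div_eq_iff hN]
  set w : ℝ → ℂ := fun x => (((1 - x) / (1 + x) : ℝ) : ℂ)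
  set k : ℝ → ℂ := fun x => w x ^ σ * ((2 / (1 - x ^ 2) : ℝ) : ℂ)
  set q : ℝ → ℂ := fun t => (starRingEnd ℂ) (mpPoly ν 0 n (Complex.I * t))
  have hw0 : ∀ x ∈ Set.Ioo (0 : ℝ) 1, 0 < (1 - x) / (1 + x) := fun x hx =>
    cayley_pos (Ioo_zero_one_subset hx)
  have hq : Integrable q (mpMeasure ν) := by
    simp_rw [q, conj_mpPoly]
    exact (ExpBoundedOnStrip.mpPoly ν 1 n one_pos).neg.integrable hν one_pos
      (by linarith [Real.pi_gt_three])
  have hk : Integrable k (volume.restrict (Set.Ioo 0 1)) := integrableOn_cayley_cpow_mul hσ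
  have h1 : ∀ t : ℝ, 1 / (ε * (Complex.I * t) + σ) * q t =
      ∫ x in Set.Ioo (0 : ℝ) 1, w x ^ ((ε : ℂ) * (Complex.I * t)) * (q t * k x) := by
    intro t
    rw [← integral_cayley_cpow (by simpa), ← integral_mul_const]
    refine setIntegral_congr_fun measurableSet_Ioo fun x hx => ?_
    simp only [k]
    rw [Complex.cpow_add _ _ (by exact_mod_cast (hw0 x hx).ne')]
    ring
  have hwm : Measurable w := Complex.measurable_ofReal.comp (by fun_prop)
  -- Since |w^{iεt}| = 1, the integrand has the modulus of the product of two integrable functions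
  -- of one variable each.
  have hint : Integrable (Function.uncurry fun (t x : ℝ) =>
      w x ^ ((ε : ℂ) * (Complex.I * t)) * (q t * k x))
      ((mpMeasure ν).prod (volume.restrict (Set.Ioo 0 1))) := by
    refine (hq.mul_prod hk).norm.mono' ?_ ?_
    · refine AEStronglyMeasurable.mul ?_ (hq.mul_prod hk).aestronglyMeasurable
      refine Measurable.aestronglyMeasurable ?_
      exact Measurable.pow (hwm.comp measurable_snd)
        ((measurable_const.mul (measurable_const.mul
          (Complex.measurable_ofReal.comp measurable_fst))))
    · have : ∀ᵐ z ∂((mpMeasure ν).prod (volume.restrict (Set.Ioo (0 : ℝ) 1))), z.2 ∈ Set.Ioo (0 : ℝ) 1 :=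
        Measure.quasiMeasurePreserving_snd.ae (ae_restrict_mem measurableSet_Ioo)
      filter_upwards [this] with z hz
      rw [Function.uncurry, norm_mul, Complex.norm_cpow_eq_rpow_re_of_pos (hw0 _ hz)]
      simp
  simp_rw [show ∀ t : ℝ, (starRingEnd ℂ) (mpPoly ν 0 n (Complex.I * t)) = q t from fun _ => rfl, h1]
  rw [integral_integral_swap hint]
  rw [mpPoleIntegral, intervalIntegral.integral_of_le zero_le_one, integral_Ioc_eq_integral_Ioo,
    mul_assoc, ← integral_mul_const, ← integral_const_mul]
  refine setIntegral_congr_fun measurableSet_Ioo fun x hx => ?_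
  rw [← mpPoleIntegral_integrand σ n hx]
  have hx' : ε * x ∈ Set.Ioo (-1 : ℝ) 1 := by
    rcases hε with rfl | rfl
    · simpa using Ioo_zero_one_subset hx
    · simpa using ⟨hx.2, by linarith [hx.1]⟩
  have hin := integral_cayley_cpow_mul_conj_mpPoly hν hx' n
  have h2 : ∀ t : ℝ, w x ^ ((ε : ℂ) * (Complex.I * t)) * (q t * k x) =
      (((1 - ε * x) / (1 + ε * x) : ℝ) : ℂ) ^ (Complex.I * t) * q t * k x := by
    intro t
    rw [← mul_assoc]
    congr 2
    rcases hε with rfl | rfl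
    · simp [w]
    · have h3 : (1 - -1 * x) / (1 + -1 * x) = ((1 - x) / (1 + x))⁻¹ := by
        rw [inv_div]; congr 1 <;> ring
      rw [h3, Complex.ofReal_inv, Complex.inv_cpow, ← Complex.cpow_neg]
      · simp [w]
      · rw [Complex.arg_ofReal_of_nonneg (hw0 x hx).le]
        exact Real.pi_ne_zero.symm
  simp_rw [h2]
  rw [integral_mul_const, hin]
  have h4 : (1 - ε * x) ^ (ν / 2) * (1 + ε * x) ^ (ν / 2) * (ε * x) ^ n =
      ε ^ n * ((1 - x) ^ (ν / 2) * (1 + x) ^ (ν / 2) * x ^ n) := by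
    rcases hε with rfl | rfl
    · simp
    · rw [mul_pow, show 1 - -1 * x = 1 + x by ring, show 1 + -1 * x = 1 - x by ring]
      ring
  rw [h4]
  simp only [k, w]
  push_cast
  ring

/-! ### Asymptotics of the pole integral -/

/-- Mean value inequality on [0, 1], where 1 ≤ 1 + x ≤ 2. The factor 1 - x raises a beta exponent by
one and so gains a factor 1/n. -/
lemma norm_one_add_cpow_sub_le (μ : ℂ) : ∃ C, 0 ≤ C ∧ ∀ x ∈ Set.Icc (0 : ℝ) 1,
    ‖((1 + x : ℝ) : ℂ) ^ μ - (2 : ℂ) ^ μ‖ ≤ C * (1 - x) := by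
  refine ⟨‖μ‖ * 2 ^ |μ.re - 1|, by positivity, fun x hx => ?_⟩
  by_cases hμ : μ = 0
  · simp [hμ]
  have h := Convex.norm_image_sub_le_of_norm_hasDerivWithin_le (s := Set.Icc (0 : ℝ) 1)
    (f := fun x : ℝ => ((1 + x : ℝ) : ℂ) ^ μ) (f' := fun x => μ * ((1 + x : ℝ) : ℂ) ^ (μ - 1))
    (C := ‖μ‖ * 2 ^ |μ.re - 1|) (x := 1) (y := x) ?_ ?_ (convex_Icc 0 1) (by simp) hx
  · rwa [Real.norm_eq_abs, abs_sub_comm x 1, abs_of_nonneg (sub_nonneg.2 hx.2), one_add_one_eq_two,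
      Complex.ofReal_ofNat] at h
  · intro y hy
    have hy1 : 1 + y ≠ 0 := by linarith [hy.1]
    have := HasDerivAt.scomp y (hasDerivAt_ofReal_cpow_const hy1 hμ) ((hasDerivAt_id y).const_add 1)
    refine (HasDerivAt.hasDerivWithinAt (this.congr_deriv ?_) :
      HasDerivWithinAt (fun x : ℝ => ((1 + x : ℝ) : ℂ) ^ μ) _ _ _)
    simp
  · intro y hy
    have h1 : 1 ≤ 1 + y := by linarith [hy.1]
    rw [norm_mul, Complex.norm_cpow_eq_rpow_re_of_pos (by linarith)]
    gcongr
    simp only [Complex.sub_re, Complex.one_re]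
    calc (1 + y) ^ (μ.re - 1) ≤ (1 + y) ^ |μ.re - 1| :=
          Real.rpow_le_rpow_of_exponent_le h1 (le_abs_self _)
      _ ≤ 2 ^ |μ.re - 1| := by
          refine Real.rpow_le_rpow (by linarith) (by linarith [hy.2]) (abs_nonneg _)

lemma integral_one_sub_cpow_mul_pow (l : ℂ) (n : ℕ) :
    ∫ x : ℝ in (0 : ℝ)..1, ((1 - x : ℝ) : ℂ) ^ (l - 1) * (x : ℂ) ^ n =
      Complex.betaIntegral l (n + 1) := by
  rw [← Complex.betaIntegral_symm, Complex.betaIntegral]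
  simp [mul_comm]

lemma intervalIntegrable_one_sub_cpow_mul_pow {l : ℂ} (hl : 0 < l.re) (n : ℕ) :
    IntervalIntegrable (fun x : ℝ => ((1 - x : ℝ) : ℂ) ^ (l - 1) * (x : ℂ) ^ n) volume 0 1 := by
  have := Complex.betaIntegral_convergent (u := (n : ℂ) + 1) (v := l)
    (by simp; positivity) hl
  simpa [mul_comm] using this

/-- Euler's sequence for Γ(l) is n^l B(l, n+1), so the size of these beta integrals follows from
Euler's limit. -/
lemma betaIntegral_nat_add_one_eq {l : ℂ} (hl : 0 < l.re) {n : ℕ} (hn : n ≠ 0) :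
    Complex.betaIntegral l (n + 1) = (n : ℂ) ^ (-l) * Complex.GammaSeq l n := by
  have hn' : (n : ℂ) ≠ 0 := by exact_mod_cast hn
  rw [Complex.GammaSeq_eq_betaIntegral_of_re_pos hl, ← mul_assoc, ← Complex.cpow_add _ _ hn']
  simp

lemma norm_natCast_cpow {n : ℕ} (hn : n ≠ 0) (z : ℂ) : ‖(n : ℂ) ^ z‖ = (n : ℝ) ^ z.re := by
  have := Complex.norm_cpow_eq_rpow_re_of_pos (x := (n : ℝ)) (by positivity) z
  simpa using this

lemma betaIntegral_nat_isBigO {l : ℂ} (hl : 0 < l.re) :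
    (fun n : ℕ => Complex.betaIntegral l (n + 1)) =O[atTop] fun n : ℕ => (n : ℝ) ^ (-l.re) := by
  have h1 : (fun n : ℕ => Complex.GammaSeq l n) =O[atTop] fun _ => (1 : ℝ) :=
    (Complex.GammaSeq_tendsto_Gamma l).isBigO_one ℝ
  have h2 : (fun n : ℕ => (n : ℂ) ^ (-l)) =O[atTop] fun n : ℕ => (n : ℝ) ^ (-l.re) := by
    refine IsBigO.of_bound 1 ?_
    filter_upwards [eventually_ne_atTop 0] with n hn
    rw [norm_natCast_cpow hn, one_mul, Complex.neg_re]
    exact le_abs_self _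
  refine (h2.mul h1).congr' ?_ (Eventually.of_forall fun n => mul_one _)
  filter_upwards [eventually_ne_atTop 0] with n hn
  rw [betaIntegral_nat_add_one_eq hl hn]

lemma betaIntegral_nat_sub_isLittleO {l : ℂ} (hl : 0 < l.re) :
    (fun n : ℕ => Complex.betaIntegral l (n + 1) - Complex.Gamma l * (n : ℂ) ^ (-l))
      =o[atTop] fun n : ℕ => (n : ℝ) ^ (-l.re) := by
  have h1 : (fun n : ℕ => Complex.GammaSeq l n - Complex.Gamma l) =o[atTop] fun _ => (1 : ℝ) :=
    (isLittleO_one_iff ℝ).2 (by simpa using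
      (Complex.GammaSeq_tendsto_Gamma l).sub_const (Complex.Gamma l))
  have h2 : (fun n : ℕ => (n : ℂ) ^ (-l)) =O[atTop] fun n : ℕ => (n : ℝ) ^ (-l.re) := by
    refine IsBigO.of_bound 1 ?_
    filter_upwards [eventually_ne_atTop 0] with n hn
    rw [norm_natCast_cpow hn, one_mul, Complex.neg_re]
    exact le_abs_self _
  refine (h2.mul_isLittleO h1).congr' ?_ (Eventually.of_forall fun n => mul_one _)
  filter_upwards [eventually_ne_atTop 0] with n hn
  rw [betaIntegral_nat_add_one_eq hl hn]
  ring

/-- As x^n concentrates at x = 1, the power of 1 + x is replaced by its value there.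
`norm_one_add_cpow_sub_le` bounds the error by a beta integral whose first parameter is real and
larger by one than the real part of the original. -/
lemma mpPoleIntegral_sub_le {ν : ℝ} (hν : 0 < ν) {σ : ℂ} (hσ : 0 < σ.re) :
    ∃ C, ∀ n : ℕ, ‖mpPoleIntegral ν σ n - (2 : ℂ) ^ (-σ + (ν : ℂ) / 2) *
      Complex.betaIntegral (σ + (ν : ℂ) / 2) (n + 1)‖ ≤
      C * ‖Complex.betaIntegral ((σ.re + ν / 2 + 1 : ℝ) : ℂ) (n + 1)‖ := by
  obtain ⟨C, hC0, hC⟩ := norm_one_add_cpow_sub_le (-σ + (ν : ℂ) / 2 - 1)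
  refine ⟨2 * C, fun n => ?_⟩
  have hl : 0 < (σ + (ν : ℂ) / 2).re := by simp; linarith
  have hl' : 0 < ((σ.re + ν / 2 + 1 : ℝ) : ℂ).re := by simp; linarith
  have i1 := intervalIntegrable_one_sub_cpow_mul_pow hl n
  have i2 := intervalIntegrable_one_sub_cpow_mul_pow hl' n
  have hcont : ContinuousOn (fun x : ℝ => 2 * (((1 + x : ℝ) : ℂ) ^ (-σ + (ν : ℂ) / 2 - 1)))
      (Set.uIcc 0 1) := by
    refine ContinuousOn.const_mul (fun x hx => ?_) _
    rw [Set.uIcc_of_le zero_le_one] at hx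
    refine ContinuousAt.continuousWithinAt ?_
    exact ContinuousAt.comp (g := fun y : ℝ => (y : ℂ) ^ (-σ + (ν : ℂ) / 2 - 1))
      (f := fun x : ℝ => 1 + x) (Complex.continuousAt_ofReal_cpow_const _ _
        (Or.inr (by linarith [hx.1]))) (by fun_prop)
  have i3 := i1.continuousOn_mul hcont
  have h2 : (2 : ℂ) ^ (-σ + (ν : ℂ) / 2) = 2 * 2 ^ (-σ + (ν : ℂ) / 2 - 1) := by
    rw [Complex.cpow_sub _ _ two_ne_zero, Complex.cpow_one]; field_simp
  have e1 : mpPoleIntegral ν σ n - (2 : ℂ) ^ (-σ + (ν : ℂ) / 2) *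
      Complex.betaIntegral (σ + (ν : ℂ) / 2) (n + 1) = ∫ x : ℝ in (0 : ℝ)..1,
        2 * (((1 + x : ℝ) : ℂ) ^ (-σ + (ν : ℂ) / 2 - 1) - 2 ^ (-σ + (ν : ℂ) / 2 - 1)) *
          (((1 - x : ℝ) : ℂ) ^ (σ + (ν : ℂ) / 2 - 1) * (x : ℂ) ^ n) := by
    rw [mpPoleIntegral, ← integral_one_sub_cpow_mul_pow, ← intervalIntegral.integral_const_mul, h2]
    rw [← intervalIntegral.integral_sub]
    · congr 1; ext x; ring
    · refine i3.congr fun x _ => ?_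
      ring
    · exact i1.const_mul _
  -- With a real parameter the beta integrand is nonnegative, so the norm of the integral is the
  -- integral of the norm.
  have e2 : ‖Complex.betaIntegral ((σ.re + ν / 2 + 1 : ℝ) : ℂ) (n + 1)‖ =
      ∫ x : ℝ in (0 : ℝ)..1, ‖((1 - x : ℝ) : ℂ) ^ (((σ.re + ν / 2 + 1 : ℝ) : ℂ) - 1) * (x : ℂ) ^ n‖ := by
    rw [← integral_one_sub_cpow_mul_pow]
    have : ∀ x ∈ Set.uIcc (0 : ℝ) 1,
        ((1 - x : ℝ) : ℂ) ^ (((σ.re + ν / 2 + 1 : ℝ) : ℂ) - 1) * (x : ℂ) ^ n =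
        ((‖((1 - x : ℝ) : ℂ) ^ (((σ.re + ν / 2 + 1 : ℝ) : ℂ) - 1) * (x : ℂ) ^ n‖ : ℝ) : ℂ) := by
      intro x hx
      rw [Set.uIcc_of_le zero_le_one] at hx
      have h3 : ((1 - x : ℝ) : ℂ) ^ (((σ.re + ν / 2 + 1 : ℝ) : ℂ) - 1) * (x : ℂ) ^ n =
          (((1 - x) ^ (σ.re + ν / 2) * x ^ n : ℝ) : ℂ) := by
        push_cast
        rw [← Complex.ofReal_one, ← Complex.ofReal_sub, Complex.ofReal_cpow (by linarith [hx.2])]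
        push_cast
        ring_nf
      have h5 : 0 ≤ (1 - x) ^ (σ.re + ν / 2) * x ^ n :=
        mul_nonneg (Real.rpow_nonneg (by linarith [hx.2]) _) (pow_nonneg hx.1 n)
      rw [h3, Complex.norm_real, Real.norm_of_nonneg h5]
    rw [intervalIntegral.integral_congr this, intervalIntegral.integral_ofReal, Complex.norm_real,
      Real.norm_of_nonneg]
    exact intervalIntegral.integral_nonneg zero_le_one fun x _ => norm_nonneg _
  rw [e1, e2, ← intervalIntegral.integral_const_mul]
  refine intervalIntegral.norm_integral_le_of_norm_le zero_le_one ?_ (i2.norm.const_mul _)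
  have hne : ∀ᵐ x : ℝ, x ≠ 1 := by simp [ae_iff, measure_singleton]
  filter_upwards [hne] with x hx1 hx
  have hx2 : x < 1 := lt_of_le_of_ne hx.2 hx1
  have h1 : 0 < 1 - x := by linarith
  have hb := hC x ⟨hx.1.le, hx.2⟩
  rw [norm_mul, norm_mul, norm_mul, norm_mul, Complex.norm_cpow_eq_rpow_re_of_pos h1,
    Complex.norm_cpow_eq_rpow_re_of_pos h1]
  have e3 : (1 - x) ^ (((σ.re + ν / 2 + 1 : ℝ) : ℂ) - 1).re =
      (1 - x) * (1 - x) ^ (σ + (ν : ℂ) / 2 - 1).re := by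
    nth_rewrite 2 [← Real.rpow_one (1 - x)]
    rw [← Real.rpow_add h1]
    congr 1
    simp
  rw [e3]
  calc ‖(2 : ℂ)‖ * ‖((1 + x : ℝ) : ℂ) ^ (-σ + (ν : ℂ) / 2 - 1) - 2 ^ (-σ + (ν : ℂ) / 2 - 1)‖ *
        ((1 - x) ^ (σ + (ν : ℂ) / 2 - 1).re * ‖(x : ℂ) ^ n‖)
      ≤ 2 * (C * (1 - x)) * ((1 - x) ^ (σ + (ν : ℂ) / 2 - 1).re * ‖(x : ℂ) ^ n‖) := by
        rw [Complex.norm_ofNat]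
        gcongr
    _ = _ := by ring

/-- Asymptotics of the coefficients of a simple fraction. -/
lemma mpPoleIntegral_isLittleO {ν : ℝ} (hν : 0 < ν) {σ : ℂ} (hσ : 0 < σ.re) :
    (fun n : ℕ => mpPoleIntegral ν σ n - (2 : ℂ) ^ (-σ + (ν : ℂ) / 2) *
      Complex.Gamma (σ + (ν : ℂ) / 2) * (n : ℂ) ^ (-σ - (ν : ℂ) / 2)) =o[atTop]
      fun n : ℕ => (n : ℝ) ^ (-σ.re - ν / 2) := by
  obtain ⟨C, hC⟩ := mpPoleIntegral_sub_le hν hσ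
  have hl : 0 < (σ + (ν : ℂ) / 2).re := by simp; linarith
  have hl' : 0 < ((σ.re + ν / 2 + 1 : ℝ) : ℂ).re := by simp; linarith
  have h1 : (fun n : ℕ => mpPoleIntegral ν σ n - (2 : ℂ) ^ (-σ + (ν : ℂ) / 2) *
      Complex.betaIntegral (σ + (ν : ℂ) / 2) (n + 1)) =o[atTop]
      fun n : ℕ => (n : ℝ) ^ (-σ.re - ν / 2) := by
    refine ((IsBigO.of_bound C (Eventually.of_forall hC)).trans
      (betaIntegral_nat_isBigO hl')).trans_isLittleO (isLittleO_natCast_rpow ?_)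
    simp only [Complex.ofReal_re]
    linarith
  have h2 := (betaIntegral_nat_sub_isLittleO hl).const_mul_left ((2 : ℂ) ^ (-σ + (ν : ℂ) / 2))
  have e : -(σ + (ν : ℂ) / 2).re = -σ.re - ν / 2 := by simp; ring
  rw [e] at h2
  refine (h1.add h2).congr_left fun n => ?_
  rw [neg_add, ← sub_eq_add_neg]
  ring

/-! ### Residues and removal of the poles -/

/-- On small circles g contributes nothing by Cauchy's theorem and c/(s-z) contributes 2πi c, so the
limit is that of an eventually constant function. -/
lemma residue_eq_of_eventuallyEq {f g : ℂ → ℂ} {z c : ℂ} (hg : AnalyticAt ℂ g z)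
    (hf : ∀ᶠ s in 𝓝[≠] z, f s = c / (s - z) + g s) : residue f z = c := by
  refine Tendsto.limUnder_eq (tendsto_const_nhds.congr' ?_)
  obtain ⟨ε, hε, hb⟩ := Metric.eventually_nhds_iff.1
    ((eventually_nhdsWithin_iff.1 hf).and hg.eventually_analyticAt)
  filter_upwards [Ioo_mem_nhdsGT hε] with r hr
  have hsub : ∀ s ∈ Metric.closedBall z r, dist s z < ε := fun s hs =>
    lt_of_le_of_lt (Metric.mem_closedBall.1 hs) hr.2
  have hgd : DifferentiableOn ℂ g (Metric.closedBall z r) := fun s hs =>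
    (hb (hsub s hs)).2.differentiableAt.differentiableWithinAt
  have h0 : circleIntegral g z r = 0 :=
    (hgd.diffContOnCl_ball (Metric.closedBall_subset_closedBall le_rfl)).circleIntegral_eq_zero hr.1.le
  have h1 : circleIntegral f z r = ∮ s in C(z, r), (c * (s - z)⁻¹ + g s) := by
    refine circleIntegral.integral_congr hr.1.le fun s hs => ?_
    have hs' := Metric.sphere_subset_closedBall hs
    rw [(hb (hsub s hs')).1 (ne_of_mem_of_not_mem hs (by simp [hr.1.ne])), div_eq_mul_inv]
  have h2 : CircleIntegrable (fun s => c * (s - z)⁻¹) z r :=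
    ContinuousOn.circleIntegrable hr.1.le (continuousOn_const.mul
      (ContinuousOn.inv₀ (by fun_prop) fun s hs => sub_ne_zero.2
        (ne_of_mem_of_not_mem hs (by simp [hr.1.ne]))))
  have h3 : CircleIntegrable g z r := ContinuousOn.circleIntegrable hr.1.le
    (hgd.continuousOn.mono Metric.sphere_subset_closedBall)
  rw [h1, circleIntegral.integral_add h2 h3, h0, circleIntegral.integral_const_mul,
    circleIntegral.integral_sub_center_inv _ hr.1.ne']
  have := Real.pi_ne_zero
  have : (Real.pi : ℂ) ≠ 0 := by exact_mod_cast this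
  field_simp [Complex.I_ne_zero]
  simp

lemma exists_analyticAt_of_order_nonneg {f : ℂ → ℂ} {z : ℂ} (hf : MeromorphicAt f z)
    (h : 0 ≤ meromorphicOrderAt f z) :
    ∃ g, AnalyticAt ℂ g z ∧ ∀ᶠ s in 𝓝[≠] z, f s = g s := by
  refine ⟨toMeromorphicNFAt f z, ?_, hf.eq_nhdsNE_toMeromorphicNFAt⟩
  rw [← meromorphicNFAt_toMeromorphicNFAt.meromorphicOrderAt_nonneg_iff_analyticAt,
    ← meromorphicOrderAt_congr hf.eq_nhdsNE_toMeromorphicNFAt]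
  exact h

lemma residue_eq_zero_of_order_nonneg {f : ℂ → ℂ} {z : ℂ} (hf : MeromorphicAt f z)
    (h : 0 ≤ meromorphicOrderAt f z) : residue f z = 0 := by
  obtain ⟨g, hg, hfg⟩ := exists_analyticAt_of_order_nonneg hf h
  refine residue_eq_of_eventuallyEq hg ?_
  simpa using hfg

lemma exists_analyticAt_of_isSimplePole {f : ℂ → ℂ} {z : ℂ} (hf : MeromorphicAt f z)
    (h : IsSimplePole f z) :
    ∃ c g, c ≠ 0 ∧ AnalyticAt ℂ g z ∧ ∀ᶠ s in 𝓝[≠] z, f s = c / (s - z) + g s := by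
  obtain ⟨F, hF, hF0, hfF⟩ := (meromorphicOrderAt_eq_int_iff hf (n := -1)).1 h
  -- Near z one has f(s) = F(s)/(s-z) and F(s) = F(z) + (s-z) `dslope F z s`.
  refine ⟨F z, dslope F z, hF0, ?_, ?_⟩
  · obtain ⟨p, hp⟩ := hF
    exact hp.has_fpower_series_dslope_fslope.analyticAt
  · filter_upwards [hfF, self_mem_nhdsWithin] with s hs hsz
    have hsz' : s - z ≠ 0 := sub_ne_zero.2 hsz
    have := sub_smul_dslope F z s
    rw [hs, zpow_neg_one, smul_eq_mul]
    rw [smul_eq_mul] at this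
    field_simp
    linear_combination -this

lemma exists_analyticAt_residue {f : ℂ → ℂ} {z : ℂ} (hf : MeromorphicAt f z)
    (h : IsSimplePole f z ∨ 0 ≤ meromorphicOrderAt f z) :
    ∃ g, AnalyticAt ℂ g z ∧ ∀ᶠ s in 𝓝[≠] z, f s = residue f z / (s - z) + g s := by
  rcases h with h | h
  · obtain ⟨c, g, -, hg, hfg⟩ := exists_analyticAt_of_isSimplePole hf h
    rw [residue_eq_of_eventuallyEq hg hfg]
    exact ⟨g, hg, hfg⟩
  · obtain ⟨g, hg, hfg⟩ := exists_analyticAt_of_order_nonneg hf h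
    rw [residue_eq_zero_of_order_nonneg hf h]
    exact ⟨g, hg, by simpa using hfg⟩

lemma residue_ne_zero {f : ℂ → ℂ} {z : ℂ} (hf : MeromorphicAt f z) (h : IsSimplePole f z) :
    residue f z ≠ 0 := by
  obtain ⟨c, g, hc, hg, hfg⟩ := exists_analyticAt_of_isSimplePole hf h
  rwa [residue_eq_of_eventuallyEq hg hfg]

/-- Removal of the removable singularities of a function. -/
lemma limUnder_eventuallyEq {h G : ℂ → ℂ} {s : ℂ} (hG : AnalyticAt ℂ G s)
    (hh : ∀ᶠ x in 𝓝[≠] s, h x = G x) :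
    (fun z => limUnder (𝓝[≠] z) h) =ᶠ[𝓝 s] G := by
  rw [eventually_nhdsWithin_iff] at hh
  filter_upwards [eventually_eventually_nhds.2 hh, hG.eventually_analyticAt] with z hz hGz
  refine Tendsto.limUnder_eq ?_
  refine (hGz.continuousAt.tendsto.mono_left nhdsWithin_le_nhds).congr' ?_
  rcases eq_or_ne z s with rfl | hzs
  · filter_upwards [eventually_nhdsWithin_of_eventually_nhds hz, self_mem_nhdsWithin] with x hx hxz
    exact (hx hxz).symm
  · filter_upwards [eventually_nhdsWithin_of_eventually_nhds (hz.and (isOpen_ne.mem_nhds hzs))]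
      with x hx
    exact (hx.1 hx.2).symm

/-- A function with at most two simple poles in a strip is, on the imaginary axis, the sum of two
simple fractions and a function holomorphic in the strip. -/
lemma exists_decomposition {α β δ r K : ℝ} {sm sp : ℂ} {f : ℂ → ℂ} (hδ : 0 < δ)
    (hsm : α + 2 < sm.re) (hsm0 : sm.re < 0) (hsp0 : 0 < sp.re) (hsp : sp.re < β - 2)
    (hmero : MeromorphicOn f (verticalStrip (α - δ) (β + δ)))
    (hana : ∀ s ∈ verticalStrip (α - δ) (β + δ), s ≠ sm → s ≠ sp → AnalyticAt ℂ f s)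
    (hsmpole : IsSimplePole f sm ∨ 0 ≤ meromorphicOrderAt f sm)
    (hsppole : IsSimplePole f sp ∨ 0 ≤ meromorphicOrderAt f sp)
    (hgrowth : f =O[cocompact ℂ ⊓ 𝓟 (verticalStrip (α - δ) (β + δ))]
      fun s : ℂ => Real.exp (r * ‖s‖)) (hα : K ≤ -α) (hβ : K ≤ β) :
    ∃ h, ExpBoundedOnStrip K (max r 0) h ∧ ∀ s : ℂ, s.re = 0 →
      f s = residue f sm / (s - sm) + residue f sp / (s - sp) + h s := by
  set cm := residue f sm
  set cp := residue f sp
  set S := verticalStrip (α - δ) (β + δ)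
  have hmS : sm ∈ S := ⟨by linarith, by linarith⟩
  have hpS : sp ∈ S := ⟨by linarith, by linarith⟩
  have hne : sm ≠ sp := fun h => by rw [h] at hsm0; linarith
  set h₀ : ℂ → ℂ := fun s => f s - (cm / (s - sm) + cp / (s - sp)) with hh₀
  have hfrac : ∀ (c z s : ℂ), s ≠ z → AnalyticAt ℂ (fun s => c / (s - z)) s := fun c z s hs =>
    analyticAt_const.div (analyticAt_id.sub analyticAt_const) (sub_ne_zero.2 hs)
  have hreg : ∀ s ∈ S, s ≠ sm → s ≠ sp → AnalyticAt ℂ h₀ s := fun s hs h1 h2 =>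
    (hana s hs h1 h2).sub ((hfrac cm sm s h1).add (hfrac cp sp s h2))
  have hG : ∀ s ∈ S, ∃ G, AnalyticAt ℂ G s ∧ ∀ᶠ x in 𝓝[≠] s, h₀ x = G x := by
    intro s hs
    by_cases h1 : s = sm
    · subst h1
      obtain ⟨g, hg, hfg⟩ := exists_analyticAt_residue (hmero s hs) hsmpole
      refine ⟨fun x => g x - cp / (x - sp), hg.sub (hfrac cp sp s hne), ?_⟩
      filter_upwards [hfg] with x hx
      rw [hh₀]
      simp only [hx, cm]
      ring
    by_cases h2 : s = sp
    · subst h2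
      obtain ⟨g, hg, hfg⟩ := exists_analyticAt_residue (hmero s hs) hsppole
      refine ⟨fun x => g x - cm / (x - sm), hg.sub (hfrac cm sm s h1), ?_⟩
      filter_upwards [hfg] with x hx
      rw [hh₀]
      simp only [hx, cp]
      ring
    exact ⟨h₀, hreg s hs h1 h2, Eventually.of_forall fun _ => rfl⟩
  -- The value of f at a pole carries no information; taking the punctured limit of h₀ at each point
  -- supplies the holomorphic extension.
  set h : ℂ → ℂ := fun z => limUnder (𝓝[≠] z) h₀ with hh
  have hana' : ∀ s ∈ S, AnalyticAt ℂ h s := fun s hs => by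
    obtain ⟨G, h1, h2⟩ := hG s hs
    exact h1.congr (limUnder_eventuallyEq h1 h2).symm
  have heq : ∀ s ∈ S, s ≠ sm → s ≠ sp → h s = h₀ s := fun s hs h1 h2 =>
    (limUnder_eventuallyEq (hreg s hs h1 h2) (Eventually.of_forall fun _ => rfl)).self_of_nhds
  have hKS : ∀ s : ℂ, |s.re| ≤ K → s ∈ S := fun s hs => by
    rw [abs_le] at hs
    exact ⟨by linarith [hs.1], by linarith [hs.2]⟩
  refine ⟨h, ⟨fun s hs => (hana' s (hKS s hs.le)).differentiableAt, ?_⟩, fun s hs => ?_⟩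
  · obtain ⟨C, hC⟩ := hgrowth.bound
    rw [eventually_inf_principal, ← Metric.cobounded_eq_cocompact,
      hasBasis_cobounded_norm.eventually_iff] at hC
    obtain ⟨R, -, hR⟩ := hC
    -- Outside the ball of radius T the growth bound holds and both poles are at distance at least
    -- 1. Inside, h is bounded on the compact set Q, which lies in the open strip because δ > 0.
    set T := max R (max (‖sm‖ + 1) (‖sp‖ + 1))
    set Q : Set ℂ := Metric.closedBall 0 T ∩ {s | |s.re| ≤ K}
    have hQ : IsCompact Q := (isCompact_closedBall _ _).inter_right
      (isClosed_le (by fun_prop) continuous_const)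
    obtain ⟨B, hB⟩ := hQ.exists_bound_of_continuousOn (f := h) fun s hs =>
      (hana' s (hKS s hs.2)).continuousAt.continuousWithinAt
    -- The rate r may be negative; with ρ ≥ 0 the exponential is at least 1 and absorbs constants,
    -- and ‖s‖ ≤ |K| + |Im s| passes to |Im s|.
    set ρ := max r 0
    have hρ : 0 ≤ ρ := le_max_right _ _
    refine ⟨max B 0 + |C| * Real.exp (ρ * |K|) + ‖cm‖ + ‖cp‖, by positivity, fun s hs => ?_⟩
    have hexp : 1 ≤ Real.exp (ρ * |s.im|) := Real.one_le_exp (by positivity)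
    have hCK : 0 ≤ |C| * Real.exp (ρ * |K|) := by positivity
    rcases le_or_gt ‖s‖ T with hsT | hsT
    · have h1 := (hB s ⟨by simpa using hsT, hs.le⟩).trans (le_max_left B 0)
      have h2 : 0 ≤ max B 0 := le_max_right _ _
      nlinarith [norm_nonneg cm, norm_nonneg cp]
    · have hT1 : R ≤ T := le_max_left _ _
      have hT2 : ‖sm‖ + 1 ≤ T := (le_max_left _ _).trans (le_max_right _ _)
      have hT3 : ‖sp‖ + 1 ≤ T := (le_max_right _ _).trans (le_max_right _ _)
      have hm1 : 1 ≤ ‖s - sm‖ := by linarith [norm_sub_norm_le s sm]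
      have hp1 : 1 ≤ ‖s - sp‖ := by linarith [norm_sub_norm_le s sp]
      have hsS := hKS s hs.le
      rw [heq s hsS (fun h => by simp [h] at hm1; linarith) (fun h => by simp [h] at hp1; linarith)]
      have hf1 : ‖f s‖ ≤ |C| * Real.exp (ρ * |K|) * Real.exp (ρ * |s.im|) := by
        refine (hR (by simp; linarith) hsS).trans ?_
        rw [Real.norm_of_nonneg (Real.exp_nonneg _), mul_assoc, ← Real.exp_add]
        have : r * ‖s‖ ≤ ρ * |K| + ρ * |s.im| := by
          have h1 := Complex.norm_le_abs_re_add_abs_im s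
          have h2 : |s.re| ≤ |K| := hs.le.trans (le_abs_self K)
          have h3 : r * ‖s‖ ≤ ρ * ‖s‖ := by gcongr; exact le_max_left _ _
          nlinarith
        gcongr
        exact le_abs_self C
      have hcm : ‖cm / (s - sm)‖ ≤ ‖cm‖ := by
        rw [norm_div]; exact div_le_self (norm_nonneg _) hm1
      have hcp : ‖cp / (s - sp)‖ ≤ ‖cp‖ := by
        rw [norm_div]; exact div_le_self (norm_nonneg _) hp1
      have h4 : ‖h₀ s‖ ≤ ‖f s‖ + (‖cm‖ + ‖cp‖) :=
        (norm_sub_le _ _).trans (add_le_add le_rfl ((norm_add_le _ _).trans (add_le_add hcm hcp)))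
      have h5 : 0 ≤ max B 0 := le_max_right _ _
      nlinarith [norm_nonneg cm, norm_nonneg cp]
  · rw [heq s ⟨by linarith, by linarith⟩ (fun h => by rw [h] at hs; linarith)
      (fun h => by rw [h] at hs; linarith), hh₀]
    ring

/-! ### Linearity of the coefficients and uniqueness of expansions -/

lemma integrable_mul_conj_mpPoly {ν : ℝ} (hν : 0 < ν) {f : ℂ → ℂ}
    (hf : MemLp (fun t : ℝ => f (Complex.I * t)) 2 (mpMeasure ν)) (n : ℕ) :
    Integrable (fun t : ℝ => f (Complex.I * t) *
      (starRingEnd ℂ) (mpPoly ν 0 n (Complex.I * t))) (mpMeasure ν) :=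
  hf.integrable_mul (memLp_mpPoly hν n).star

lemma mpCoeff_add {ν : ℝ} (hν : 0 < ν) {f g : ℂ → ℂ}
    (hf : MemLp (fun t : ℝ => f (Complex.I * t)) 2 (mpMeasure ν))
    (hg : MemLp (fun t : ℝ => g (Complex.I * t)) 2 (mpMeasure ν)) (n : ℕ) :
    mpCoeff ν (fun s => f s + g s) n = mpCoeff ν f n + mpCoeff ν g n := by
  simp only [mpCoeff, add_mul]
  rw [integral_add (integrable_mul_conj_mpPoly hν hf n)
    (integrable_mul_conj_mpPoly hν hg n), add_div]

lemma mpCoeff_const_mul (ν : ℝ) (c : ℂ) (f : ℂ → ℂ) (n : ℕ) :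
    mpCoeff ν (fun s => c * f s) n = c * mpCoeff ν f n := by
  simp only [mpCoeff, mul_assoc, integral_const_mul, mul_div_assoc]

lemma mpCoeff_congr {ν : ℝ} {f g : ℂ → ℂ} (h : ∀ t : ℝ, f (Complex.I * t) = g (Complex.I * t))
    (n : ℕ) : mpCoeff ν f n = mpCoeff ν g n := by
  simp only [mpCoeff, h]

lemma mpCoeff_mpPoly {ν : ℝ} (hν : 0 < ν) (m n : ℕ) :
    mpCoeff ν (mpPoly ν 0 m) n = if m = n then 1 else 0 := by
  rw [mpCoeff_eq hν, integral_mpPoly_mul_conj hν]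
  have hN : (mpNormSq ν n : ℂ) ≠ 0 := by exact_mod_cast (mpNormSq_pos hν n).ne'
  split_ifs with h
  · rw [h, div_self hN]
  · simp

lemma memLp_sum_mpPoly {ν : ℝ} (hν : 0 < ν) (a : ℕ → ℂ) (N : ℕ) :
    MemLp (fun t : ℝ => ∑ n ∈ Finset.range N, a n * mpPoly ν 0 n (Complex.I * t)) 2
      (mpMeasure ν) :=
  memLp_finsetSum _ fun n _ => (memLp_mpPoly hν n).const_mul (a n)

lemma mpCoeff_sum_mpPoly {ν : ℝ} (hν : 0 < ν) (a : ℕ → ℂ) (m N : ℕ) :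
    mpCoeff ν (fun s => ∑ n ∈ Finset.range N, a n * mpPoly ν 0 n s) m =
      if m < N then a m else 0 := by
  induction N with
  | zero => simp [mpCoeff]
  | succ N ih =>
    simp only [Finset.sum_range_succ]
    rw [mpCoeff_add hν (f := fun s => ∑ n ∈ Finset.range N, a n * mpPoly ν 0 n s)
      (g := fun s => a N * mpPoly ν 0 N s)
      (memLp_sum_mpPoly hν a N) ((memLp_mpPoly hν N).const_mul (a N)), ih, mpCoeff_const_mul,
      mpCoeff_mpPoly hν]
    rcases lt_trichotomy m N with h | rfl | h
    · simp [h, h.ne', h.trans (Nat.lt_succ_self N)]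
    · simp
    · simp [h.ne, h.not_gt, h.not_ge]

/-- Uniqueness of Meixner-Pollaczek expansions. -/
lemma HasMPExpansion.eq_mpCoeff {ν : ℝ} (hν : 0 < ν) {f : ℂ → ℂ} {a : ℕ → ℂ}
    (hf : MemLp (fun t : ℝ => f (Complex.I * t)) 2 (mpMeasure ν)) (h : HasMPExpansion ν f a) :
    a = mpCoeff ν f := by
  ext m
  set B : ℝ := (mpNormSq ν m)⁻¹ ^ (1 / 2 : ℝ)
  set u : ℕ → ℂ → ℂ := fun N s => f s + -1 * ∑ n ∈ Finset.range N, a n * mpPoly ν 0 n s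
  have hu : ∀ N, MemLp (fun t : ℝ => u N (Complex.I * t)) 2 (mpMeasure ν) := fun N =>
    hf.add ((memLp_sum_mpPoly hν a N).const_mul (-1))
  have hcoeff : ∀ N, m < N → mpCoeff ν (u N) m = mpCoeff ν f m - a m := fun N hN => by
    rw [mpCoeff_add hν (g := fun s => -1 * ∑ n ∈ Finset.range N, a n * mpPoly ν 0 n s) hf
      ((memLp_sum_mpPoly hν a N).const_mul (-1)), mpCoeff_const_mul ν (-1) (fun s => ∑ n ∈ Finset.range N, a n * mpPoly ν 0 n s),
      mpCoeff_sum_mpPoly hν, if_pos hN]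
    ring
  have hnorm : ∀ N, (∫ t : ℝ, ‖u N (Complex.I * t)‖ ^ 2 ∂mpMeasure ν) ^ (1 / 2 : ℝ) =
      (eLpNorm (fun t : ℝ => u N (Complex.I * t)) 2 (mpMeasure ν)).toReal := fun N => by
    rw [(hu N).eLpNorm_eq_integral_rpow_norm (by norm_num) (by norm_num), ENNReal.toReal_ofReal]
    · simp
    · positivity
  have hlim : Tendsto (fun N : ℕ => (eLpNorm (fun t : ℝ => u N (Complex.I * t)) 2
      (mpMeasure ν)).toReal * B) atTop (𝓝 0) := by
    have h1 : Tendsto (fun N : ℕ => eLpNorm (fun t : ℝ => u N (Complex.I * t)) 2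
      (mpMeasure ν)) atTop (𝓝 0) := by
      refine h.congr fun N => ?_
      simp only [u, sub_eq_add_neg, neg_one_mul]
    have := ((ENNReal.tendsto_toReal ENNReal.zero_ne_top).comp h1).mul_const B
    simpa using this
  -- For N > m the m-th coefficient of the remainder u_N does not depend on N, while it is bounded
  -- by a multiple of the L²-norm of u_N, which tends to 0.
  have hle : ‖mpCoeff ν f m - a m‖ ≤ 0 := by
    refine ge_of_tendsto hlim ?_
    filter_upwards [eventually_gt_atTop m] with N hN
    rw [← hcoeff N hN, ← hnorm]
    exact norm_mpCoeff_le hν (hu N) m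
  exact (sub_eq_zero.1 (norm_le_zero_iff.1 hle)).symm

/-! ### The error term a_n - R_n -/

/-- Half the distance from the axis to the pole is enough here: the bound serves to put the fraction
in L²(M_ν). -/
lemma ExpBoundedOnStrip.one_div {ε : ℝ} (hε : ε = 1 ∨ ε = -1) {σ : ℂ} (hσ : 0 < σ.re) :
    ExpBoundedOnStrip (σ.re / 2) 0 (fun s => 1 / (ε * s + σ)) := by
  have hre : ∀ s : ℂ, |s.re| < σ.re / 2 → σ.re / 2 ≤ ((ε : ℂ) * s + σ).re := fun s hs => by
    rw [abs_lt] at hs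
    rcases hε with rfl | rfl <;> simp <;> linarith [hs.1, hs.2]
  have hn : ∀ s : ℂ, |s.re| < σ.re / 2 → σ.re / 2 ≤ ‖(ε : ℂ) * s + σ‖ := fun s hs =>
    (hre s hs).trans (Complex.re_le_norm _)
  refine ⟨fun s hs => ?_, (σ.re / 2)⁻¹, by positivity, fun s hs => ?_⟩
  · have : (ε : ℂ) * s + σ ≠ 0 := norm_pos_iff.1 (lt_of_lt_of_le (by linarith) (hn s hs))
    fun_prop (disch := assumption)
  · rw [zero_mul, Real.exp_zero, mul_one, norm_div, norm_one, _root_.one_div]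
    exact inv_anti₀ (by linarith) (hn s hs)

lemma norm_negOnePow_mul (n : ℕ) (z : ℂ) : ‖(-1 : ℂ) ^ n * z‖ = ‖z‖ := by
  simp

/-- The coefficients of a sum of two simple fractions and a function holomorphic in a strip. -/
lemma mpCoeff_sub_mainTerm_isLittleO {ν K r : ℝ} {sm sp : ℂ} {f h : ℂ → ℂ} (hν : 0 < ν)
    (hsm0 : sm.re < 0) (hsp0 : 0 < sp.re) (hK : 0 ≤ K) (hr : r < Real.pi / 2)
    (H : ExpBoundedOnStrip (K + 2) r h)
    (hf : ∀ s : ℂ, s.re = 0 → f s = residue f sm / (s - sm) + residue f sp / (s - sp) + h s)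
    (hm : residue f sm = 0 ∨ K ≤ -sm.re) (hp : residue f sp = 0 ∨ K ≤ sp.re) :
    MemLp (fun t : ℝ => f (Complex.I * t)) 2 (mpMeasure ν) ∧
    (fun n : ℕ => mpCoeff ν f n - mpMainTerm ν f sm sp n) =o[atTop]
      fun n : ℕ => (n : ℝ) ^ (-K - ν / 2) := by
  set cm := residue f sm with hcm
  set cp := residue f sp with hcp
  -- Both fractions are normalised so that σ has positive real part: σ = -s₋ with ε = 1, and σ = s₊
  -- with ε = -1. The latter changes the sign of c₊, hence (-1)^{n+1} in the main term.
  set u : ℂ → ℂ := fun s => 1 / ((1 : ℝ) * s + -sm)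
  set v : ℂ → ℂ := fun s => 1 / ((-1 : ℝ) * s + sp)
  have hσm : 0 < (-sm).re := by simpa using hsm0
  have hu := ((ExpBoundedOnStrip.one_div (Or.inl rfl) hσm).memLp hν (half_pos hσm)
    (half_pos Real.pi_pos) : MemLp (fun t : ℝ => u (Complex.I * t)) 2 (mpMeasure ν))
  have hv := ((ExpBoundedOnStrip.one_div (Or.inr rfl) hsp0).memLp hν (half_pos hsp0)
    (half_pos Real.pi_pos) : MemLp (fun t : ℝ => v (Complex.I * t)) 2 (mpMeasure ν))
  have hh := H.memLp hν (by linarith) hr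
  have hdec : ∀ t : ℝ, f (Complex.I * t) = cm * u (Complex.I * t) + -cp * v (Complex.I * t) +
      h (Complex.I * t) := by
    intro t
    rw [hf _ (by simp)]
    have e1 : ((1 : ℝ) : ℂ) * (Complex.I * t) + -sm = Complex.I * t - sm := by push_cast; ring
    have e2 : ((-1 : ℝ) : ℂ) * (Complex.I * t) + sp = -(Complex.I * t - sp) := by push_cast; ring
    simp only [u, v, e1, e2]
    rw [div_neg]
    ring
  have hcu := hu.const_mul cm
  have hcv := hv.const_mul (-cp)
  refine ⟨by simp_rw [hdec]; exact (hcu.add hcv).add hh, ?_⟩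
  have hcoeff : ∀ n, mpCoeff ν f n = cm * mpPoleIntegral ν (-sm) n +
      -cp * ((-1) ^ n * mpPoleIntegral ν sp n) + mpCoeff ν h n := by
    intro n
    rw [mpCoeff_congr (g := fun s => cm * u s + -cp * v s + h s) hdec,
      mpCoeff_add hν (f := fun s => cm * u s + -cp * v s) (hcu.add hcv) hh,
      mpCoeff_add hν (f := fun s => cm * u s) (g := fun s => -cp * v s) hcu hcv,
      mpCoeff_const_mul, mpCoeff_const_mul, mpCoeff_one_div hν (Or.inl rfl) hσm,
      mpCoeff_one_div hν (Or.inr rfl) hsp0]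
    simp
  have hle : ∀ {p : ℝ}, K ≤ p → (fun n : ℕ => (n : ℝ) ^ (-p - ν / 2)) =O[atTop]
      fun n : ℕ => (n : ℝ) ^ (-K - ν / 2) := by
    intro p hp
    refine IsBigO.of_bound 1 ?_
    filter_upwards [eventually_ge_atTop 1] with n hn
    have hn1 : (1 : ℝ) ≤ n := by exact_mod_cast hn
    rw [one_mul, Real.norm_of_nonneg (by positivity), Real.norm_of_nonneg (by positivity)]
    exact Real.rpow_le_rpow_of_exponent_le hn1 (by linarith)
  have h1 : (fun n : ℕ => cm * (mpPoleIntegral ν (-sm) n - (2 : ℂ) ^ (-(-sm) + (ν : ℂ) / 2) *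
      Complex.Gamma (-sm + (ν : ℂ) / 2) * (n : ℂ) ^ (-(-sm) - (ν : ℂ) / 2))) =o[atTop]
      fun n : ℕ => (n : ℝ) ^ (-K - ν / 2) := by
    -- A vanishing residue removes the term and with it the constraint on K, so that K can later be
    -- adapted to a single pole.
    rcases hm with h0 | h0
    · simp_rw [h0, zero_mul]
      exact isLittleO_zero _ _
    · exact ((mpPoleIntegral_isLittleO hν hσm).const_mul_left cm).trans_isBigO
        (hle (p := (-sm).re) (by simpa using h0))
  have h2 : (fun n : ℕ => -cp * ((-1) ^ n * (mpPoleIntegral ν sp n -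
      (2 : ℂ) ^ (-sp + (ν : ℂ) / 2) *
      Complex.Gamma (sp + (ν : ℂ) / 2) * (n : ℂ) ^ (-sp - (ν : ℂ) / 2)))) =o[atTop]
      fun n : ℕ => (n : ℝ) ^ (-K - ν / 2) := by
    rcases hp with h0 | h0
    · simp_rw [h0, neg_zero, zero_mul]
      exact isLittleO_zero _ _
    · refine IsLittleO.const_mul_left (IsLittleO.of_norm_left ?_) (-cp)
      simp_rw [norm_negOnePow_mul]
      exact ((mpPoleIntegral_isLittleO hν hsp0).norm_left).trans_isBigO (hle h0)
  have h3 := H.mpCoeff_isLittleO hν hK le_rfl hr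
  refine ((h1.add h2).add h3).congr_left fun n => ?_
  rw [hcoeff, mpMainTerm, constAminus, constAplus, ← hcm, ← hcp, neg_neg, pow_succ]
  ring

/-! ### Lower bounds for R_n and the quotient -/

/-- Along the indices with R_n ≠ 0 the lower bound gives g = O(R), so a - R = o(R) there. -/
lemma tendsto_div_of_isLittleO {a R : ℕ → ℂ} {g : ℕ → ℝ} {c : ℝ} (hc : 0 < c)
    (ho : (fun n => a n - R n) =o[atTop] g) (hlow : ∀ᶠ n in atTop, R n ≠ 0 → c * ‖g n‖ ≤ ‖R n‖) :
    Tendsto (fun n => a n / R n) (atTop ⊓ 𝓟 {n | R n ≠ 0}) (𝓝 1) := by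
  have hO : g =O[atTop ⊓ 𝓟 {n | R n ≠ 0}] R := by
    refine IsBigO.of_bound c⁻¹ ?_
    rw [eventually_inf_principal]
    filter_upwards [hlow] with n hn hR
    rw [inv_mul_eq_div, le_div_iff₀ hc, mul_comm]
    exact hn hR
  have h := ((ho.mono inf_le_left).trans_isBigO hO).tendsto_div_nhds_zero.add_const 1
  rw [zero_add] at h
  refine h.congr' ?_
  rw [EventuallyEq, eventually_inf_principal]
  filter_upwards with n hR
  rw [sub_div, div_self hR, sub_add_cancel]

lemma exists_mul_rpow_le {a b p q : ℝ} (ha : 0 < a) (hqp : q < p) :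
    ∀ᶠ n : ℕ in atTop, a / 2 * (n : ℝ) ^ p ≤ a * (n : ℝ) ^ p - b * (n : ℝ) ^ q := by
  have h := ((isLittleO_natCast_rpow hqp).const_mul_left b).def (half_pos ha)
  filter_upwards [h] with n hn
  rw [Real.norm_of_nonneg (by positivity : (0 : ℝ) ≤ (n : ℝ) ^ p)] at hn
  have := (le_abs_self _).trans hn
  linarith

/-- Lower bound for the main term where it does not vanish. -/
lemma exists_mul_rpow_le_norm_mainTerm {ν : ℝ} {sm sp : ℂ} {f : ℂ → ℂ}
    (hA : constAminus ν f sm ≠ 0) (hB : constAplus ν f sp ≠ 0)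
    (h : sp.re ≠ -sm.re ∨ ‖constAminus ν f sm‖ ≠ ‖constAplus ν f sp‖ ∨ sp = -sm) :
    ∃ c > 0, ∀ᶠ n : ℕ in atTop, mpMainTerm ν f sm sp n ≠ 0 →
      c * ‖(n : ℝ) ^ (-min (-sm.re) sp.re - ν / 2)‖ ≤ ‖mpMainTerm ν f sm sp n‖ := by
  set A := constAminus ν f sm with hAdef
  set B := constAplus ν f sp with hBdef
  have hterm : ∀ n : ℕ, n ≠ 0 → ‖A * (n : ℂ) ^ (sm - (ν : ℂ) / 2)‖ =
      ‖A‖ * (n : ℝ) ^ (sm.re - ν / 2) ∧ ‖(-1) ^ (n + 1) * B * (n : ℂ) ^ (-sp - (ν : ℂ) / 2)‖ =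
      ‖B‖ * (n : ℝ) ^ (-sp.re - ν / 2) := fun n hn => by
    simp [norm_natCast_cpow hn]
  have hlow : ∀ n : ℕ, n ≠ 0 → |‖A‖ * (n : ℝ) ^ (sm.re - ν / 2) -
      ‖B‖ * (n : ℝ) ^ (-sp.re - ν / 2)| ≤ ‖mpMainTerm ν f sm sp n‖ := fun n hn => by
    rw [← (hterm n hn).1, ← (hterm n hn).2, mpMainTerm, ← norm_neg ((-1) ^ (n + 1) * B * _)]
    refine (abs_norm_sub_norm_le _ _).trans (le_of_eq ?_)
    rw [sub_neg_eq_add]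
  have hA0 : 0 < ‖A‖ := norm_pos_iff.2 hA
  have hB0 : 0 < ‖B‖ := norm_pos_iff.2 hB
  by_cases hre : sp.re = -sm.re
  · rcases h with h | h | h
    · exact absurd hre h
    -- Equal exponents but different moduli: the reverse triangle inequality suffices.
    · refine ⟨|‖A‖ - ‖B‖|, abs_pos.2 (sub_ne_zero.2 h), ?_⟩
      filter_upwards [eventually_ne_atTop 0] with n hn _
      refine le_trans (le_of_eq ?_) (hlow n hn)
      rw [hre, min_self, neg_neg, ← sub_mul, abs_mul, Real.norm_eq_abs]
    -- Here R_n is A + B or A - B, by the parity of n + 1, times one power of n. If one of these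
    -- constants is 0, R_n vanishes on that parity class and nothing is required; the value 1 only
    -- keeps c positive.
    · set d : ℂ → ℝ := fun z => if z = 0 then 1 else ‖z‖
      have hd : ∀ z, 0 < d z := fun z => by
        simp only [d]; split_ifs with hz
        · exact one_pos
        · exact norm_pos_iff.2 hz
      refine ⟨min (d (A + B)) (d (A - B)), lt_min (hd _) (hd _), ?_⟩
      filter_upwards [eventually_ne_atTop 0] with n hn hR
      have e : mpMainTerm ν f sm sp n = (A + (-1) ^ (n + 1) * B) * (n : ℂ) ^ (sm - (ν : ℂ) / 2) := by
        rw [mpMainTerm, ← hAdef, ← hBdef, h, neg_neg]; ring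
      rw [e] at hR ⊢
      have hne := left_ne_zero_of_mul hR
      rw [norm_mul, norm_natCast_cpow hn, hre, min_self, neg_neg,
        Real.norm_of_nonneg (by positivity)]
      simp only [Complex.sub_re, Complex.div_ofNat_re, Complex.ofReal_re]
      gcongr
      rcases neg_one_pow_eq_or ℂ (n + 1) with h1 | h1 <;> rw [h1] at hne ⊢
      · rw [one_mul] at hne ⊢
        refine (min_le_left _ _).trans (le_of_eq ?_)
        simp only [d, if_neg hne]
      · rw [neg_one_mul, ← sub_eq_add_neg] at hne ⊢
        refine (min_le_right _ _).trans (le_of_eq ?_)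
        simp only [d, if_neg hne]
  -- With different exponents the larger term eventually exceeds the smaller one, leaving at least
  -- half of it.
  · rcases lt_or_gt_of_ne hre with hlt | hlt
    · refine ⟨‖B‖ / 2, half_pos hB0, ?_⟩
      filter_upwards [eventually_ne_atTop 0, exists_mul_rpow_le (b := ‖A‖) hB0
        (show sm.re - ν / 2 < -sp.re - ν / 2 by linarith)] with n hn h1 _
      rw [min_eq_right hlt.le, Real.norm_of_nonneg (by positivity)]
      refine h1.trans (le_trans ?_ (hlow n hn))
      rw [abs_sub_comm]
      exact le_abs_self _
    · refine ⟨‖A‖ / 2, half_pos hA0, ?_⟩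
      filter_upwards [eventually_ne_atTop 0, exists_mul_rpow_le (b := ‖B‖) hA0
        (show -sp.re - ν / 2 < sm.re - ν / 2 by linarith)] with n hn h1 _
      rw [min_eq_left hlt.le, Real.norm_of_nonneg (by positivity), neg_neg]
      exact h1.trans ((le_abs_self _).trans (hlow n hn))

lemma constAminus_ne_zero {ν : ℝ} (hν : 0 < ν) {f : ℂ → ℂ} {sm : ℂ} (hsm0 : sm.re < 0)
    (h : residue f sm ≠ 0) : constAminus ν f sm ≠ 0 :=
  mul_ne_zero (mul_ne_zero (by simp [Complex.cpow_eq_zero_iff]) h)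
    (Complex.Gamma_ne_zero_of_re_pos (by simp; linarith))

lemma constAplus_ne_zero {ν : ℝ} (hν : 0 < ν) {f : ℂ → ℂ} {sp : ℂ} (hsp0 : 0 < sp.re)
    (h : residue f sp ≠ 0) : constAplus ν f sp ≠ 0 :=
  mul_ne_zero (mul_ne_zero (by simp [Complex.cpow_eq_zero_iff]) h)
    (Complex.Gamma_ne_zero_of_re_pos (by simp; linarith))

end

/-! ### Proof of the theorem -/

theorem mainTheorem2 (ν α β δ r : ℝ) (sm sp : ℂ) (f : ℂ → ℂ)
    (hν : 0 < ν) (hδ : 0 < δ)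
    (hsm : α + 2 < sm.re) (hsm0 : sm.re < 0) (hsp0 : 0 < sp.re) (hsp : sp.re < β - 2)
    -- `f` is meromorphic on the strip, with no singularity other than `sm` and `sp`
    (hmero : MeromorphicOn f (verticalStrip (α - δ) (β + δ)))
    (hana : ∀ s ∈ verticalStrip (α - δ) (β + δ), s ≠ sm → s ≠ sp → AnalyticAt ℂ f s)
    -- at each of these two points `f` has at most a simple pole, and at least one is a pole
    (hsmpole : IsSimplePole f sm ∨ 0 ≤ meromorphicOrderAt f sm)
    (hsppole : IsSimplePole f sp ∨ 0 ≤ meromorphicOrderAt f sp)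
    (hpole : IsSimplePole f sm ∨ IsSimplePole f sp)
    (hr : r < Real.pi / 2)
    (hgrowth : f =O[cocompact ℂ ⊓ 𝓟 (verticalStrip (α - δ) (β + δ))]
      fun s : ℂ => Real.exp (r * ‖s‖)) :
    -- `f(it)` lies in `L²(M_ν)`, and its coefficients are those of any expansion of it
    MemLp (fun t : ℝ => f (Complex.I * t)) 2 (mpMeasure ν) ∧
    (∀ a : ℕ → ℂ, HasMPExpansion ν f a → a = mpCoeff ν f) ∧
    -- the difference of the two sides is of smaller order than the larger of the two terms
    ((fun n : ℕ => mpCoeff ν f n - mpMainTerm ν f sm sp n) =o[atTop]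
      fun n : ℕ => (n : ℝ) ^ (-min (-sm.re) sp.re - ν / 2)) ∧
    -- the quotient of the two sides tends to one along the `n` where the right side is nonzero
    ((¬ IsSimplePole f sp → -sm.re < β - 2) →
      (¬ IsSimplePole f sm → α + 2 < -sp.re) →
      (sp.re ≠ -sm.re ∨ ‖constAminus ν f sm‖ ≠ ‖constAplus ν f sp‖ ∨ sp = -sm) →
      Tendsto (fun n : ℕ => mpCoeff ν f n / mpMainTerm ν f sm sp n)
        (atTop ⊓ 𝓟 {n : ℕ | mpMainTerm ν f sm sp n ≠ 0}) (𝓝 1)) := by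
  have hmS : sm ∈ verticalStrip (α - δ) (β + δ) := ⟨by linarith, by linarith⟩
  have hpS : sp ∈ verticalStrip (α - δ) (β + δ) := ⟨by linarith, by linarith⟩
  have hr0 : max r 0 < Real.pi / 2 := max_lt hr (half_pos Real.pi_pos)
  -- K stays free: the general estimate takes the smaller distance of the two points from the axis,
  -- whereas with a single pole K is the distance of that pole, even when it is the larger one.
  have key : ∀ K : ℝ, 0 ≤ K → K + 2 ≤ -α → K + 2 ≤ β → (residue f sm = 0 ∨ K ≤ -sm.re) →
      (residue f sp = 0 ∨ K ≤ sp.re) →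
      MemLp (fun t : ℝ => f (Complex.I * t)) 2 (mpMeasure ν) ∧
      (fun n : ℕ => mpCoeff ν f n - mpMainTerm ν f sm sp n) =o[atTop]
        fun n : ℕ => (n : ℝ) ^ (-K - ν / 2) := by
    intro K hK0 hK1 hK2 hm hp
    obtain ⟨h, H, hf⟩ := exists_decomposition hδ hsm hsm0 hsp0 hsp hmero hana hsmpole hsppole
      hgrowth hK1 hK2
    exact mpCoeff_sub_mainTerm_isLittleO hν hsm0 hsp0 hK0 hr0 H hf hm hp
  have hmin0 : 0 ≤ min (-sm.re) sp.re := le_min (by linarith) hsp0.le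
  obtain ⟨hL2, ho⟩ := key (min (-sm.re) sp.re) hmin0
    (by linarith [min_le_left (-sm.re) sp.re]) (by linarith [min_le_right (-sm.re) sp.re])
    (Or.inr (min_le_left _ _)) (Or.inr (min_le_right _ _))
  refine ⟨hL2, fun a ha => ha.eq_mpCoeff hν hL2, ho, fun hβ hα hne => ?_⟩
  by_cases hmp : IsSimplePole f sm
  · have hA := constAminus_ne_zero hν hsm0 (residue_ne_zero (hmero sm hmS) hmp)
    by_cases hpp : IsSimplePole f sp
    · have hB := constAplus_ne_zero hν hsp0 (residue_ne_zero (hmero sp hpS) hpp)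
      obtain ⟨c, hc, hlow⟩ := exists_mul_rpow_le_norm_mainTerm hA hB hne
      exact tendsto_div_of_isLittleO hc ho hlow
    · have h0 := residue_eq_zero_of_order_nonneg (hmero sp hpS) (hsppole.resolve_left hpp)
      -- Only s₋ is a pole, so R_n is a single power of n and K = -Re s₋. The condition K + 2 ≤ β
      -- comes from the extra hypothesis on a lone pole.
      refine tendsto_div_of_isLittleO (norm_pos_iff.2 hA) (key (-sm.re) (by linarith) (by linarith)
        (by linarith [hβ hpp]) (Or.inr le_rfl) (Or.inl h0)).2 ?_
      filter_upwards [eventually_ne_atTop 0] with n hn _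
      refine le_of_eq ?_
      rw [mpMainTerm, constAplus, h0, Real.norm_of_nonneg (by positivity)]
      simp [norm_natCast_cpow hn]
  · have hpp := hpole.resolve_left hmp
    have hB := constAplus_ne_zero hν hsp0 (residue_ne_zero (hmero sp hpS) hpp)
    have h0 := residue_eq_zero_of_order_nonneg (hmero sm hmS) (hsmpole.resolve_left hmp)
    -- The mirror case K = Re s₊, where the extra hypothesis provides K + 2 ≤ -α.
    refine tendsto_div_of_isLittleO (norm_pos_iff.2 hB) (key sp.re hsp0.le (by linarith [hα hmp])
      (by linarith) (Or.inl h0) (Or.inr le_rfl)).2 ?_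
    filter_upwards [eventually_ne_atTop 0] with n hn _
    refine le_of_eq ?_
    rw [mpMainTerm, constAminus, h0, Real.norm_of_nonneg (by positivity)]
    simp [norm_natCast_cpow hn]
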